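/- Let $a\in\mathbb R$, $\lambda\ge 0$, $\beta\in(0,1)$ and let $p_{01},p_{11}$ be probabilities with $0<p_{01}\le p_{11}\le 1$ and $a^2(1-p_{01})<1$. Put $\mathcal T(b)=b\,p_{11}+(1-b)\,p_{01}$. The original POMDP is the Markov decision process with state $(e,b)\in\mathbb R\times[0,1]$ (estimation error, belief that the channel is good), actions $u\in\{0,1\}$ ($1$ = transmit), one-stage cost $e^2+\lambda u$, and transition law $P(\cdot\mid e,b;0)=\mathcal N(ae,1)\otimes\delta_{\mathcal T(b)}$, $P(\cdot\mid e,b;1)=b\,\mathcal N(0,1)\otimes\delta_{p_{11}}+(1-b)\,\mathcal N(ae,1)\otimes\delta_{p_{01}}$. The folded POMDP has state space $\mathbb R_+\times[0,1]$, the same actions and cost, and the transition density $\tilde p(\tilde e_+,b_+\mid\tilde e,b;u)=p(\tilde e_+,b_+\mid\tilde e,b;u)+p(-\tilde e_+,b_+\mid\tilde e,b;u)$, where $p$ is the transition density of the original POMDP. Let $V^\beta$, $\tilde V^\beta$ be the infima, over all measurable history-dependent policies $\phi$, of the expected total discounted cost $\mathbb E_\phi\sum_{t\ge0}\beta^t(e(t)^2+\lambda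 u(t))$ of the two problems, and let $Q^\beta(e,b;u)=e^2+\lambda u+\beta\int V^\beta\,dP(\cdot\mid e,b;u)$, and $\tilde Q^\beta$ likewise for the folded POMDP. Then $V^\beta$ is finite, $V^\beta(e,b)=\min_{u}Q^\beta(e,b;u)$, and for all $e\in\mathbb R$, $b\in[0,1]$, $u\in\{0,1\}$ one has $V^\beta(e,b)=\tilde V^\beta(|e|,b)$ and $Q^\beta(e,b;u)=\tilde Q^\beta(|e|,b;u)$. Moreover: (A) for each $b$, $V^\beta(\cdot,b)$ is non-decreasing in $|e|$: $|e|\le|e'|$ implies $V^\beta(e,b)\le V^\beta(e',b)$; (B) for each $e$, $V^\beta(e,\cdot)$ is non-increasing in $b$; (C) for all $e$ and all beliefs $x\ge y$, $b$ and $z=bx+(1-b)y$ in $[0,1]$, $(1-b)\lambda+b\,V^\beta(e,x)+(1-b)V^\beta(e,y)\ge V^\beta(e,z)$; (D) there is a function $\tilde b^\star:\mathbb R_+\to\mathbb R$ such that, with $b^\star(e)=\tilde b^\star(|e|)$: for all $e\in\mathbb R$ and $b\in[0,1]$, transmitting is optimal at $(e,b)$, i.e. $Q^\beta(e,b;1)\le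 Q^\beta(e,b;0)$, if and only if $b\ge b^\star(e)$; the stationary policy that transmits exactly when $b\ge b^\star(e)$ is measurable and optimal from every initial state; and every optimal stationary policy transmits only when $b\ge b^\star(e)$. The same three assertions hold for the folded POMDP with the threshold $\tilde b^\star$. (A value $\tilde b^\star(\tilde e)>1$ means that it is never optimal to transmit at error $\tilde e$.) -/

import Mathlib

open MeasureTheory ProbabilityTheory unitInterval
open scoped ENNReal NNReal

noncomputable section

/-! Discounted Markov decision processes with action set `{0, 1}`, written as `Bool`
(`true` is action `1`, "transmit"; `false` is action `0`, "do not transmit"). -/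

/-- A Markov decision process with state space `S`, actions in `Bool`, a Markov transition kernel
and a nonnegative one-stage cost. -/
structure MDP (S : Type) [MeasurableSpace S] where
  /-- law of the next state, given the current state and action -/
  trans : Kernel (S × Bool) S
  markov : IsMarkovKernel trans
  /-- one-stage cost -/
  cost : S → Bool → ℝ≥0∞

/-- A policy: at each time `t`, a measurable map from the history of states up to time `t`
to an action. -/
structure Policy (S : Type) [MeasurableSpace S] where
  act : (t : ℕ) → (Finset.Iic t → S) → Bool
  measurable_act : ∀ t, Measurable (act t)

/-- A stationary policy: a measurable function of the current state. -/
structure StationaryPolicy (S : Type) [MeasurableSpace S] where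
  act : S → Bool
  measurable_act : Measurable act

namespace StationaryPolicy

variable {S : Type} [MeasurableSpace S]

/-- A stationary policy, seen as a policy. -/
def toPolicy (φ : StationaryPolicy S) : Policy S where
  act t h := φ.act (h ⟨t, Finset.mem_Iic.2 le_rfl⟩)
  measurable_act _ := φ.measurable_act.comp (measurable_pi_apply _)

end StationaryPolicy

namespace MDP

variable {S : Type} [MeasurableSpace S]

/-- Under the policy `φ`, the conditional law of the state at time `t + 1`, given the history up
to time `t`. -/
def stepKernel (M : MDP S) (φ : Policy S) (t : ℕ) : Kernel (Finset.Iic t → S) S :=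
  M.trans.comap (fun h => (h ⟨t, Finset.mem_Iic.2 le_rfl⟩, φ.act t h))
    ((measurable_pi_apply _).prodMk (φ.measurable_act t))

instance (M : MDP S) (φ : Policy S) (t : ℕ) : IsMarkovKernel (M.stepKernel φ t) :=
  haveI := M.markov
  inferInstanceAs (IsMarkovKernel (M.trans.comap _ _))

/-- The law of the state trajectory under the policy `φ`, from the initial state `s`
(Ionescu-Tulcea). -/
def pathLaw (M : MDP S) (φ : Policy S) (s : S) : Measure (ℕ → S) :=
  Kernel.traj (X := fun _ => S) (M.stepKernel φ) 0 (fun _ => s)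

/-- The expected total `β`-discounted cost of the policy `φ` from the initial state `s`. -/
def policyCost (M : MDP S) (β : ℝ) (φ : Policy S) (s : S) : ℝ≥0∞ :=
  ∫⁻ ω, ∑' t : ℕ, ENNReal.ofReal β ^ t * M.cost (ω t) (φ.act t (fun i => ω i)) ∂(M.pathLaw φ s)

/-- The `β`-discounted optimal value function. -/
def value (M : MDP S) (β : ℝ) (s : S) : ℝ≥0∞ := ⨅ φ : Policy S, M.policyCost β φ s

/-- The `Q`-function: cost of the action `u` followed by optimal continuation. -/
def qValue (M : MDP S) (β : ℝ) (s : S) (u : Bool) : ℝ≥0∞ :=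
  M.cost s u + ENNReal.ofReal β * ∫⁻ s', M.value β s' ∂(M.trans (s, u))

/-- The action `u` is optimal in the state `s`: it minimizes the `Q`-function. -/
def OptimalAction (M : MDP S) (β : ℝ) (s : S) (u : Bool) : Prop :=
  ∀ v : Bool, M.qValue β s u ≤ M.qValue β s v

/-- The policy `φ` is optimal from every initial state. -/
def IsOptimal (M : MDP S) (β : ℝ) (φ : Policy S) : Prop :=
  ∀ s, M.policyCost β φ s = M.value β s

/-- For a state consisting of an error and a belief: `thr` is an optimal threshold function.
At error `e`, transmitting is optimal exactly for the beliefs `b ≥ thr e`; the stationary policy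
which transmits exactly when `b ≥ thr e` is optimal; and every optimal stationary policy transmits
only when `b ≥ thr e`. (A value `thr e > 1` means that one never transmits at error `e`.) -/
def HasOptimalThreshold {E : Type} [MeasurableSpace E] (M : MDP (E × I)) (β : ℝ)
    (thr : E → ℝ) : Prop :=
  (∀ (e : E) (b : I), M.OptimalAction β (e, b) true ↔ thr e ≤ b) ∧
  (∃ φ : StationaryPolicy (E × I),
    (∀ (e : E) (b : I), φ.act (e, b) = true ↔ thr e ≤ b) ∧ M.IsOptimal β φ.toPolicy) ∧
  (∀ φ : StationaryPolicy (E × I), M.IsOptimal β φ.toPolicy →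
    ∀ (e : E) (b : I), φ.act (e, b) = true → thr e ≤ b)

end MDP

/-! The scheduling problem. The state is `(e, b)`: the estimation error and the belief, i.e. the
conditional probability that the channel is good. -/

/-- Belief after one step without transmission, `b * p₁₁ + (1 - b) * p₀₁`. -/
def beliefUpdate (p01 p11 b : I) : I :=
  ⟨b * p11 + (1 - b) * p01, by
    have hb := b.2; have h0 := p01.2; have h1 := p11.2
    constructor
    · exact add_nonneg (mul_nonneg hb.1 h1.1) (mul_nonneg (sub_nonneg.2 hb.2) h0.1)
    · nlinarith [mul_le_mul_of_nonneg_left h1.2 hb.1,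
        mul_le_mul_of_nonneg_left h0.2 (sub_nonneg.2 hb.2)]⟩

lemma measurable_beliefUpdate (p01 p11 : I) : Measurable (beliefUpdate p01 p11) := by
  unfold beliefUpdate
  fun_prop

/-- Transition law of the scheduling problem for an error space `E`. Here `err m` is the law of the next error when
the undisturbed next error is `m`, and `val e` is the real number that the error `e` stands for.
Without transmission the next state is distributed as `err (a e) ⊗ δ_{b p₁₁ + (1 - b) p₀₁}`; with
transmission it is distributed as `b • err 0 ⊗ δ_{p₁₁} + (1 - b) • err (a e) ⊗ δ_{p₀₁}`. -/
def scheduleLaw {E : Type} [MeasurableSpace E] (err : Kernel ℝ E) (val : E → ℝ)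
    (a : ℝ) (p01 p11 : I) (s : (E × I) × Bool) : Measure (E × I) :=
  if s.2 = true then
    ENNReal.ofReal (s.1.2 : ℝ) • (err 0).prod (Measure.dirac p11) +
      ENNReal.ofReal (1 - (s.1.2 : ℝ)) • (err (a * val s.1.1)).prod (Measure.dirac p01)
  else (err (a * val s.1.1)).prod (Measure.dirac (beliefUpdate p01 p11 s.1.2))

lemma measurable_scheduleLaw {E : Type} [MeasurableSpace E] (err : Kernel ℝ E)
    [IsMarkovKernel err] (val : E → ℝ) (hval : Measurable val) (a : ℝ) (p01 p11 : I) :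
    Measurable (scheduleLaw err val a p01 p11) := by
  have hm : Measurable (fun s : (E × I) × Bool => a * val s.1.1) := by fun_prop
  have key : ∀ g : (E × I) × Bool → I, Measurable g →
      Measurable (fun s => (err (a * val s.1.1)).prod (Measure.dirac (g s))) := by
    intro g hg
    have := ((err.comap _ hm) ×ₖ (Kernel.deterministic g hg)).measurable
    convert this using 2 with s
    rw [Kernel.prod_apply, Kernel.comap_apply, Kernel.deterministic_apply]
  refine Measurable.ite (measurableSet_eq_fun measurable_snd measurable_const) ?_
    (key _ ((measurable_beliefUpdate p01 p11).comp (by fun_prop)))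
  refine Measure.measurable_of_measurable_coe _ fun t ht => ?_
  simp only [Measure.coe_add, Measure.coe_smul, Pi.add_apply, Pi.smul_apply, smul_eq_mul]
  have h1 := (Measure.measurable_coe ht).comp (key (fun _ => p01) measurable_const)
  have h2 : Measurable (fun s : (E × I) × Bool => (s.1.2 : ℝ)) := by fun_prop
  exact (h2.ennreal_ofReal.mul_const _).add ((h2.const_sub 1).ennreal_ofReal.mul h1)

/-- The scheduling problem as a Markov decision process, with one-stage cost `e ^ 2 + lam * u`. -/
def scheduleMDP {E : Type} [MeasurableSpace E] (err : Kernel ℝ E) [IsMarkovKernel err]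
    (val : E → ℝ) (hval : Measurable val) (a lam : ℝ) (p01 p11 : I) : MDP (E × I) where
  trans := ⟨scheduleLaw err val a p01 p11, measurable_scheduleLaw err val hval a p01 p11⟩
  markov := ⟨fun s => ⟨by
    change scheduleLaw err val a p01 p11 s Set.univ = 1
    unfold scheduleLaw
    split_ifs
    · have hb := s.1.2.2
      simp only [Measure.coe_add, Measure.coe_smul, Pi.add_apply, Pi.smul_apply, smul_eq_mul,
        measure_univ, mul_one]
      rw [← ENNReal.ofReal_add hb.1 (sub_nonneg.2 hb.2)]
      simp
    · simp⟩⟩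
  cost s u := ENNReal.ofReal (val s.1 ^ 2 + lam * (if u = true then 1 else 0))

/-- Law of the next error of the original problem: `m + w` with `w ~ N(0, 1)`. -/
def gaussianErr : Kernel ℝ ℝ where
  toFun m := gaussianReal m 1
  measurable' := measurable_gaussianReal.comp (measurable_id.prodMk measurable_const)

instance : IsMarkovKernel gaussianErr :=
  ⟨fun m => inferInstanceAs (IsProbabilityMeasure (gaussianReal m 1))⟩

/-- The folded Gaussian law on the nonnegative reals: its density with respect to Lebesgue measure
at `x` is the sum of the densities of `N(m, 1)` at `x` and at `-x`. -/
def foldedGaussian (m : ℝ) : Measure ℝ≥0 :=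
  ((volume : Measure ℝ).comap ((↑) : ℝ≥0 → ℝ)).withDensity
    (fun x => gaussianPDF m 1 x + gaussianPDF m 1 (-x))

lemma measurable_nnabs : Measurable Real.nnabs := by
  have : (Real.nnabs : ℝ → ℝ≥0) = fun x => Real.toNNReal |x| := by
    funext x
    ext
    simp
  rw [this]
  fun_prop

lemma foldedGaussian_eq_map (m : ℝ) :
    foldedGaussian m = (gaussianReal m 1).map Real.nnabs := by
  have hn : Measurable Real.nnabs := measurable_nnabs
  have hg : Measurable (gaussianPDF m 1) := measurable_gaussianPDF m 1
  ext t ht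
  rw [Measure.map_apply hn ht, gaussianReal_apply m one_ne_zero, foldedGaussian,
    withDensity_apply _ ht, ← lintegral_indicator ht, ← lintegral_indicator (hn ht)]
  set F : ℝ → ℝ≥0∞ := (Real.nnabs ⁻¹' t).indicator (gaussianPDF m 1) with hF
  have hFm : Measurable F := hg.indicator (hn ht)
  have e1 : (t.indicator fun x : ℝ≥0 => gaussianPDF m 1 x + gaussianPDF m 1 (-x)) =
      fun x : ℝ≥0 => F x + F (-x) := by
    funext x
    have h1 : Real.nnabs (x : ℝ) = x := Real.nnabs_coe x
    have h2 : Real.nnabs (-(x : ℝ)) = x := by ext; simp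
    by_cases hx : x ∈ t <;> simp only [hF, Set.indicator, Set.mem_preimage, h1, h2, hx] <;> simp
  rw [e1]
  have hs : MeasurableSet {x : ℝ | 0 ≤ x} := measurableSet_Ici
  have e2 : ∫⁻ x : ℝ≥0, F x + F (-x) ∂((volume : Measure ℝ).comap ((↑) : ℝ≥0 → ℝ)) =
      ∫⁻ x in Set.Ici (0 : ℝ), F x + F (-x) :=
    lintegral_subtype_comap hs (fun x : ℝ => F x + F (-x))
  rw [e2, lintegral_add_left hFm]
  have e3 : ∫⁻ x in Set.Ici (0 : ℝ), F (-x) = ∫⁻ x in Set.Iic (0 : ℝ), F x := by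
    have := (Measure.measurePreserving_neg (volume : Measure ℝ)).setLIntegral_comp_preimage
      (measurableSet_Iic (a := (0 : ℝ))) hFm
    rw [← this]
    simp
  rw [e3, setLIntegral_congr (Iio_ae_eq_Iic (μ := (volume : Measure ℝ)) (a := 0)).symm]
  have := lintegral_add_compl (μ := (volume : Measure ℝ)) F (measurableSet_Ici (a := (0 : ℝ)))
  rwa [Set.compl_Ici] at this

/-- Law of the next error of the folded problem. -/
def foldedErr : Kernel ℝ ℝ≥0 where
  toFun := foldedGaussian
  measurable' := by
    have : foldedGaussian = fun m => (gaussianReal m 1).map Real.nnabs :=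
      funext foldedGaussian_eq_map
    rw [this]
    exact (Measure.measurable_map _ measurable_nnabs).comp
      gaussianErr.measurable

instance : IsMarkovKernel foldedErr := ⟨fun m => by
  change IsProbabilityMeasure (foldedGaussian m)
  rw [foldedGaussian_eq_map]
  exact Measure.isProbabilityMeasure_map measurable_nnabs.aemeasurable⟩

/-- The original problem, on the state space `ℝ × [0, 1]`. -/
def originalPOMDP (a lam : ℝ) (p01 p11 : I) : MDP (ℝ × I) :=
  scheduleMDP gaussianErr id measurable_id a lam p01 p11

/-- The folded problem, on the state space `ℝ≥0 × [0, 1]`. -/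
def foldedPOMDP (a lam : ℝ) (p01 p11 : I) : MDP (ℝ≥0 × I) :=
  scheduleMDP foldedErr (fun e => (e : ℝ)) measurable_subtype_coe a lam p01 p11

end

/-! All costs are nonnegative, so value iteration started at zero increases, and by monotone
convergence its limit solves the optimality equation. No policy costs less than this limit and a
greedy stationary policy costs no more, so the limit is the value function (`value_eq_iSup`). It is
therefore enough to find properties that hold for zero, survive the Bellman operator and pass to
increasing limits.

The invariant is `StructuredValue`: (A), (B), (C) and, in addition, concavity in the belief. (A)
survives because the modulus of a Gaussian variable is stochastically increasing in the modulus of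
its mean. For the rest, fix the error `e` and drop the common cost `e ^ 2` (`BeliefStage`). Waiting
costs `β * c b`, where `c` inherits concavity, (B) and (C) because the belief update is affine and
increasing; transmitting has a cost affine in `b`. Transmitting minus waiting is thus convex in `b`.
By (C) between the beliefs `1` and `0`, if transmitting is no worse at some belief, it is no worse
at `1`; convexity then extends this to every belief in between. This gives the threshold, and a
limiting argument shows that it is attained. The threshold in turn makes (C) survive (`best_mix`):
at `y ≤ x`, either transmitting is best at `x`, and the affine cost of transmitting exceeds the best
cost at `y` by at most `lam`, or waiting is best at both.

Finiteness comes from a quadratic supersolution, obtained from always transmitting; this is where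
the stability condition enters. Folding is harmless since the dynamics at `-e` mirror those at `e`,
so all iterates are even in the error. -/

noncomputable section

/-! ### Dynamic programming with nonnegative costs and two actions -/

namespace MDP

variable {S : Type} [MeasurableSpace S]

/-- The cost of the action `u` in the state `s`, followed by the terminal cost `v`. -/
def bellmanQ (M : MDP S) (β : ℝ) (v : S → ℝ≥0∞) (s : S) (u : Bool) : ℝ≥0∞ :=
  M.cost s u + ENNReal.ofReal β * ∫⁻ s', v s' ∂(M.trans (s, u))

/-- The Bellman operator. -/
def bellman (M : MDP S) (β : ℝ) (v : S → ℝ≥0∞) (s : S) : ℝ≥0∞ :=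
  min (M.bellmanQ β v s false) (M.bellmanQ β v s true)

/-- Value iteration, started at zero. -/
def valueIter (M : MDP S) (β : ℝ) : ℕ → S → ℝ≥0∞
  | 0 => fun _ => 0
  | n + 1 => M.bellman β (valueIter M β n)

/-- The expected discounted cost of a stationary policy over a finite horizon. -/
def policyIter (M : MDP S) (β : ℝ) (φ : StationaryPolicy S) : ℕ → S → ℝ≥0∞
  | 0 => fun _ => 0
  | n + 1 => fun s => M.bellmanQ β (policyIter M β φ n) s (φ.act s)

variable (M : MDP S) (β : ℝ)

lemma bellmanQ_mono {v w : S → ℝ≥0∞} (h : ∀ s, v s ≤ w s) (s : S) (u : Bool) :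
    M.bellmanQ β v s u ≤ M.bellmanQ β w s u := by
  unfold bellmanQ
  gcongr
  exact h _

lemma bellman_mono {v w : S → ℝ≥0∞} (h : ∀ s, v s ≤ w s) (s : S) :
    M.bellman β v s ≤ M.bellman β w s :=
  min_le_min (M.bellmanQ_mono β h s _) (M.bellmanQ_mono β h s _)

lemma bellman_le_bellmanQ (v : S → ℝ≥0∞) (s : S) (u : Bool) :
    M.bellman β v s ≤ M.bellmanQ β v s u := by
  cases u
  · exact min_le_left _ _
  · exact min_le_right _ _

lemma measurable_bellmanQ (hc : ∀ u, Measurable fun s => M.cost s u) {v : S → ℝ≥0∞}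
    (hv : Measurable v) (u : Bool) : Measurable fun s => M.bellmanQ β v s u := by
  have h : Measurable fun s : S => (s, u) := by fun_prop
  exact (hc u).add (((hv.lintegral_kernel (κ := M.trans)).comp h).const_mul _)

lemma measurable_bellman (hc : ∀ u, Measurable fun s => M.cost s u) {v : S → ℝ≥0∞}
    (hv : Measurable v) : Measurable (M.bellman β v) :=
  (M.measurable_bellmanQ β hc hv false).min (M.measurable_bellmanQ β hc hv true)

lemma measurable_stationary (φ : StationaryPolicy S) {f : S → Bool → ℝ≥0∞}
    (hf : ∀ u, Measurable fun s => f s u) : Measurable fun s => f s (φ.act s) := by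
  have : (fun s => f s (φ.act s)) = fun s => if φ.act s = true then f s true else f s false := by
    funext s
    cases φ.act s <;> simp
  rw [this]
  exact Measurable.ite (φ.measurable_act (measurableSet_singleton true)) (hf _) (hf _)

lemma measurable_valueIter (hc : ∀ u, Measurable fun s => M.cost s u) (n : ℕ) :
    Measurable (M.valueIter β n) := by
  induction n with
  | zero => exact measurable_const
  | succ n ih => exact M.measurable_bellman β hc ih

lemma measurable_policyIter (hc : ∀ u, Measurable fun s => M.cost s u) (φ : StationaryPolicy S)
    (n : ℕ) : Measurable (M.policyIter β φ n) := by
  induction n with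
  | zero => exact measurable_const
  | succ n ih => exact measurable_stationary φ (M.measurable_bellmanQ β hc ih)

lemma monotone_valueIter : Monotone (M.valueIter β) := by
  refine monotone_nat_of_le_succ fun n => ?_
  induction n with
  | zero => exact fun s => zero_le
  | succ n ih => exact fun s => M.bellman_mono β ih s

lemma monotone_policyIter (φ : StationaryPolicy S) : Monotone (M.policyIter β φ) := by
  refine monotone_nat_of_le_succ fun n => ?_
  induction n with
  | zero => exact fun s => zero_le
  | succ n ih => exact fun s => M.bellmanQ_mono β ih s _

lemma bellmanQ_iSup {v : ℕ → S → ℝ≥0∞} (hm : ∀ n, Measurable (v n)) (hv : Monotone v) (s : S)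
    (u : Bool) :
    M.bellmanQ β (fun s => ⨆ n, v n s) s u = ⨆ n, M.bellmanQ β (v n) s u := by
  unfold bellmanQ
  rw [lintegral_iSup hm hv, ENNReal.mul_iSup, ENNReal.add_iSup]

/-- Monotone convergence handles each action, and the minimum of two increasing sequences commutes
with the supremum. No contraction argument is used, so infinite values are allowed. -/
lemma bellman_iSup {v : ℕ → S → ℝ≥0∞} (hm : ∀ n, Measurable (v n)) (hv : Monotone v) (s : S) :
    M.bellman β (fun s => ⨆ n, v n s) s = ⨆ n, M.bellman β (v n) s := by
  have hQ (u : Bool) : Monotone fun n => M.bellmanQ β (v n) s u :=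
    fun m n h => M.bellmanQ_mono β (hv h) s u
  simp only [bellman, M.bellmanQ_iSup β hm hv]
  exact (iSup_inf_of_monotone (hQ false) (hQ true)).symm

/-! ### The trajectory measure -/

instance (φ : Policy S) (s : S) : IsProbabilityMeasure (M.pathLaw φ s) :=
  inferInstanceAs (IsProbabilityMeasure (Kernel.traj (X := fun _ => S) (M.stepKernel φ) 0 _))

lemma lintegral_pathLaw_zero (φ : Policy S) (s : S) {g : S → ℝ≥0∞} (hg : Measurable g) :
    ∫⁻ ω, g (ω 0) ∂(M.pathLaw φ s) = g s := by
  have h := Kernel.traj_map_frestrictLe_apply (X := fun _ => S) (κ := M.stepKernel φ) 0 0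
    (fun _ => s)
  rw [Kernel.partialTraj_self, Kernel.id_apply] at h
  have hG : Measurable fun x : Finset.Iic 0 → S => g (x ⟨0, Finset.mem_Iic.2 le_rfl⟩) := by
    fun_prop
  have h2 := congrArg (fun μ => ∫⁻ x, g (x ⟨0, Finset.mem_Iic.2 le_rfl⟩) ∂μ) h
  simp only [lintegral_dirac' _ hG] at h2
  rw [lintegral_map hG (by fun_prop)] at h2
  exact h2

/-- The Markov property: the trajectory law factors through the history up to time `k`, and given
that history the next coordinate has law `stepKernel φ k`. -/
lemma lintegral_pathLaw_succ (φ : Policy S) (s : S) {g : S → ℝ≥0∞} (hg : Measurable g) (k : ℕ) :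
    ∫⁻ ω, g (ω (k + 1)) ∂(M.pathLaw φ s) =
      ∫⁻ ω, ∫⁻ s', g s' ∂(M.trans (ω k, φ.act k (fun i => ω i))) ∂(M.pathLaw φ s) := by
  have hG : Measurable fun ω : ℕ → S => g (ω (k + 1)) := by fun_prop
  have hK : Measurable fun h : Finset.Iic k → S => ∫⁻ s', g s' ∂(M.stepKernel φ k h) :=
    hg.lintegral_kernel
  have hstep (h : Finset.Iic k → S) :
      ∫⁻ ω, g (ω (k + 1)) ∂(Kernel.traj (X := fun _ => S) (M.stepKernel φ) k h) =
        ∫⁻ s', g s' ∂(M.stepKernel φ k h) := by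
    conv_rhs => rw [← Kernel.map_traj_succ_self (X := fun _ => S) (κ := M.stepKernel φ)]
    rw [Kernel.map_apply _ (by fun_prop), lintegral_map hg (by fun_prop)]
  have h1 : M.pathLaw φ s = ((Kernel.traj (X := fun _ => S) (M.stepKernel φ) k) ∘ₖ
      (Kernel.partialTraj (X := fun _ => S) (M.stepKernel φ) 0 k)) (fun _ => s) := by
    rw [Kernel.traj_comp_partialTraj (Nat.zero_le k)]
    rfl
  conv_lhs => rw [h1, Kernel.lintegral_comp _ _ _ hG]
  simp_rw [hstep]
  rw [← Kernel.traj_map_frestrictLe_apply, lintegral_map hK (by fun_prop)]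
  rfl

/-- The expected cost of a policy over the first `n` stages. -/
def horizonCost (φ : Policy S) (s : S) (n : ℕ) : ℝ≥0∞ :=
  ∑ t ∈ Finset.range n,
    ∫⁻ ω, ENNReal.ofReal β ^ t * M.cost (ω t) (φ.act t (fun i => ω i)) ∂(M.pathLaw φ s)

lemma measurable_act_path (φ : Policy S) (t : ℕ) :
    Measurable fun ω : ℕ → S => φ.act t (fun i => ω i) :=
  (φ.measurable_act t).comp (by fun_prop)

lemma measurable_stage (φ : Policy S) (t : ℕ) {f : S → Bool → ℝ≥0∞}
    (hf : ∀ u, Measurable fun s => f s u) :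
    Measurable fun ω : ℕ → S => f (ω t) (φ.act t (fun i => ω i)) := by
  have : (fun ω : ℕ → S => f (ω t) (φ.act t (fun i => ω i))) =
      fun ω => if φ.act t (fun i => ω i) = true then f (ω t) true else f (ω t) false := by
    funext ω
    cases φ.act t (fun i => ω i) <;> simp
  rw [this]
  exact Measurable.ite (measurable_act_path φ t (measurableSet_singleton true))
    ((hf _).comp (measurable_pi_apply t)) ((hf _).comp (measurable_pi_apply t))

lemma policyCost_eq_iSup (hc : ∀ u, Measurable fun s => M.cost s u) (φ : Policy S) (s : S) :
    M.policyCost β φ s = ⨆ n, M.horizonCost β φ s n := by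
  unfold policyCost
  rw [lintegral_tsum fun t => ((measurable_stage φ t hc).const_mul _).aemeasurable,
    ENNReal.tsum_eq_iSup_nat]
  rfl

/-- This identity moves one stage of cost out of a terminal cost; it is the induction step of both
finite-horizon comparisons below. -/
lemma lintegral_bellmanQ_stage (hc : ∀ u, Measurable fun s => M.cost s u) (φ : Policy S) (s : S)
    {g : S → ℝ≥0∞} (hg : Measurable g) (k : ℕ) :
    ENNReal.ofReal β ^ k *
        ∫⁻ ω, M.bellmanQ β g (ω k) (φ.act k (fun i => ω i)) ∂(M.pathLaw φ s) =
      ∫⁻ ω, ENNReal.ofReal β ^ k * M.cost (ω k) (φ.act k (fun i => ω i)) ∂(M.pathLaw φ s) +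
      ENNReal.ofReal β ^ (k + 1) * ∫⁻ ω, g (ω (k + 1)) ∂(M.pathLaw φ s) := by
  have hi : Measurable fun ω : ℕ → S =>
      ∫⁻ s', g s' ∂(M.trans (ω k, φ.act k (fun i => ω i))) :=
    measurable_stage φ k (f := fun s u => ∫⁻ s', g s' ∂(M.trans (s, u))) fun u =>
      (hg.lintegral_kernel (κ := M.trans)).comp (by fun_prop)
  unfold bellmanQ
  rw [M.lintegral_pathLaw_succ φ s hg, lintegral_add_left (measurable_stage φ k hc),
    lintegral_const_mul _ hi, lintegral_const_mul _ (measurable_stage φ k hc), mul_add, pow_succ,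
    mul_assoc]

lemma valueIter_le_horizonCost (hc : ∀ u, Measurable fun s => M.cost s u) (φ : Policy S) (s : S)
    (n : ℕ) : M.valueIter β n s ≤ M.horizonCost β φ s n := by
  -- Splitting the horizon: `k` stages follow `φ`, the remaining `m` are optimal. Raising `k`
  -- replaces one optimal stage by the action of `φ`, which can only raise the cost.
  have key (k m : ℕ) : M.valueIter β (m + k) s ≤ M.horizonCost β φ s k +
      ENNReal.ofReal β ^ k * ∫⁻ ω, M.valueIter β m (ω k) ∂(M.pathLaw φ s) := by
    induction k generalizing m with
    | zero =>
      rw [M.lintegral_pathLaw_zero φ s (M.measurable_valueIter β hc m)]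
      simp [horizonCost]
    | succ k ih =>
      have h1 := ih (m + 1)
      rw [show m + 1 + k = m + (k + 1) by ring] at h1
      refine h1.trans ?_
      rw [horizonCost, horizonCost, Finset.sum_range_succ, add_assoc,
        ← M.lintegral_bellmanQ_stage β hc φ s (M.measurable_valueIter β hc m)]
      gcongr
      exact M.bellman_le_bellmanQ β _ _ _
  have h := key n 0
  simpa [valueIter] using h

lemma policyIter_eq_horizonCost (hc : ∀ u, Measurable fun s => M.cost s u)
    (φ : StationaryPolicy S) (s : S) (n : ℕ) :
    M.policyIter β φ n s = M.horizonCost β φ.toPolicy s n := by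
  -- The same splitting, now with equality, since every stage uses the action of `φ`.
  have key (k m : ℕ) : M.policyIter β φ (m + k) s = M.horizonCost β φ.toPolicy s k +
      ENNReal.ofReal β ^ k * ∫⁻ ω, M.policyIter β φ m (ω k) ∂(M.pathLaw φ.toPolicy s) := by
    induction k generalizing m with
    | zero =>
      rw [M.lintegral_pathLaw_zero φ.toPolicy s (M.measurable_policyIter β hc φ m)]
      simp [horizonCost]
    | succ k ih =>
      have h1 := ih (m + 1)
      rw [show m + 1 + k = m + (k + 1) by ring] at h1
      rw [h1, horizonCost, horizonCost, Finset.sum_range_succ, add_assoc,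
        ← M.lintegral_bellmanQ_stage β hc φ.toPolicy s (M.measurable_policyIter β hc φ m)]
      rfl
  have h := key n 0
  simpa [policyIter] using h

lemma policyCost_stationary (hc : ∀ u, Measurable fun s => M.cost s u) (φ : StationaryPolicy S)
    (s : S) : M.policyCost β φ.toPolicy s = ⨆ n, M.policyIter β φ n s := by
  simp_rw [M.policyCost_eq_iSup β hc, ← M.policyIter_eq_horizonCost β hc]

lemma iSup_valueIter_le_policyCost (hc : ∀ u, Measurable fun s => M.cost s u) (φ : Policy S)
    (s : S) : ⨆ n, M.valueIter β n s ≤ M.policyCost β φ s := by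
  rw [M.policyCost_eq_iSup β hc]
  exact iSup_mono (M.valueIter_le_horizonCost β hc φ s)

lemma bellman_iSup_valueIter (hc : ∀ u, Measurable fun s => M.cost s u) (s : S) :
    M.bellman β (fun s => ⨆ n, M.valueIter β n s) s = ⨆ n, M.valueIter β n s := by
  rw [M.bellman_iSup β (M.measurable_valueIter β hc) (M.monotone_valueIter β)]
  exact (monotone_nat_of_le_succ fun n => M.monotone_valueIter β n.le_succ s :
    Monotone fun n => M.valueIter β n s).iSup_nat_add 1

/-- A stationary policy that is greedy for the limit of value iteration costs at most this limit. -/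
lemma policyCost_le_of_greedy (hc : ∀ u, Measurable fun s => M.cost s u) (φ : StationaryPolicy S)
    (hφ : ∀ s, M.bellmanQ β (fun s => ⨆ n, M.valueIter β n s) s (φ.act s) ≤
      ⨆ n, M.valueIter β n s) (s : S) :
    M.policyCost β φ.toPolicy s ≤ ⨆ n, M.valueIter β n s := by
  rw [M.policyCost_stationary β hc]
  refine iSup_le fun n => ?_
  induction n generalizing s with
  | zero => exact zero_le
  -- The limit is a supersolution of the recursion for `φ`, and that recursion starts at zero, below
  -- it.
  | succ n ih => exact (M.bellmanQ_mono β ih s _).trans (hφ s)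

/-- The value function is the limit of value iteration. -/
lemma value_eq_iSup (hc : ∀ u, Measurable fun s => M.cost s u) (s : S) :
    M.value β s = ⨆ n, M.valueIter β n s := by
  have hm : Measurable fun s => ⨆ n, M.valueIter β n s :=
    Measurable.iSup (M.measurable_valueIter β hc)
  refine le_antisymm ?_ (le_iInf fun φ => M.iSup_valueIter_le_policyCost β hc φ s)
  classical
  let φ : StationaryPolicy S :=
    { act := fun s => decide (M.bellmanQ β (fun s => ⨆ n, M.valueIter β n s) s true ≤
        M.bellmanQ β (fun s => ⨆ n, M.valueIter β n s) s false)
      measurable_act := by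
        refine measurable_to_bool ?_
        simpa [Set.preimage] using measurableSet_le (M.measurable_bellmanQ β hc hm true)
          (M.measurable_bellmanQ β hc hm false) }
  refine (iInf_le _ φ.toPolicy).trans (M.policyCost_le_of_greedy β hc φ (fun s => ?_) s)
  conv_rhs => rw [← M.bellman_iSup_valueIter β hc s]
  by_cases h : M.bellmanQ β (fun s => ⨆ n, M.valueIter β n s) s true ≤
      M.bellmanQ β (fun s => ⨆ n, M.valueIter β n s) s false
  · have : φ.act s = true := decide_eq_true h
    rw [this, bellman, min_eq_right h]
  · have : φ.act s = false := decide_eq_false h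
    rw [this, bellman, min_eq_left (not_le.1 h).le]

lemma value_eq_iSup_fun (hc : ∀ u, Measurable fun s => M.cost s u) :
    M.value β = fun s => ⨆ n, M.valueIter β n s :=
  funext (M.value_eq_iSup β hc)

lemma measurable_value (hc : ∀ u, Measurable fun s => M.cost s u) : Measurable (M.value β) := by
  rw [M.value_eq_iSup_fun β hc]
  exact Measurable.iSup (M.measurable_valueIter β hc)

/-- The optimality equation. -/
lemma value_eq_min (hc : ∀ u, Measurable fun s => M.cost s u) (s : S) :
    M.value β s = min (M.qValue β s false) (M.qValue β s true) := by
  have h := (M.bellman_iSup_valueIter β hc s).symm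
  rw [← M.value_eq_iSup_fun β hc, ← M.value_eq_iSup β hc] at h
  exact h

/-- A stationary policy is optimal if it always takes an optimal action. -/
lemma isOptimal_of_forall_optimalAction (hc : ∀ u, Measurable fun s => M.cost s u)
    (φ : StationaryPolicy S) (hφ : ∀ s, M.OptimalAction β s (φ.act s)) :
    M.IsOptimal β φ.toPolicy := by
  intro s
  refine le_antisymm ?_ (iInf_le _ _)
  rw [M.value_eq_iSup β hc]
  refine M.policyCost_le_of_greedy β hc φ (fun s => ?_) s
  rw [← M.value_eq_iSup_fun β hc, ← M.value_eq_iSup β hc, M.value_eq_min β hc]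
  exact le_min (hφ s _) (hφ s _)

/-- An optimal stationary policy always takes an optimal action. -/
lemma optimalAction_of_isOptimal (hc : ∀ u, Measurable fun s => M.cost s u)
    (φ : StationaryPolicy S) (hφ : M.IsOptimal β φ.toPolicy) (s : S) :
    M.OptimalAction β s (φ.act s) := by
  have h : M.qValue β s (φ.act s) = M.value β s := by
    -- The cost of `φ` solves the fixed-point equation of `φ`. As this cost is the value, the action
    -- of `φ` attains the minimum in the optimality equation.
    have hv : M.value β = fun s => ⨆ n, M.policyIter β φ n s := by
      funext s
      rw [← hφ s, M.policyCost_stationary β hc]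
    change M.bellmanQ β (M.value β) s (φ.act s) = M.value β s
    rw [hv, M.bellmanQ_iSup β (M.measurable_policyIter β hc φ) (M.monotone_policyIter β φ)]
    exact (monotone_nat_of_le_succ fun n => M.monotone_policyIter β φ n.le_succ s :
      Monotone fun n => M.policyIter β φ n s).iSup_nat_add 1
  intro v
  rw [h, M.value_eq_min β hc]
  cases v
  · exact min_le_left _ _
  · exact min_le_right _ _

lemma optimalAction_true_iff (s : S) :
    M.OptimalAction β s true ↔ M.qValue β s true ≤ M.qValue β s false := by
  simp [OptimalAction, Bool.forall_bool]

/-- A threshold that describes where action `1` is optimal is an optimal threshold. -/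
lemma hasOptimalThreshold_of_optimalAction_iff {E : Type} [MeasurableSpace E] (M : MDP (E × I))
    (β : ℝ) (hc : ∀ u, Measurable fun s => M.cost s u) (thr : E → ℝ)
    (h : ∀ (e : E) (b : I), M.OptimalAction β (e, b) true ↔ thr e ≤ b) :
    M.HasOptimalThreshold β thr := by
  classical
  refine ⟨h, ?_, fun φ hφ e b hb => ?_⟩
  · let φ : StationaryPolicy (E × I) :=
      { act := fun s => decide (M.OptimalAction β s true)
        measurable_act := by
          refine measurable_to_bool ?_
          have hQ (u : Bool) : Measurable fun s => M.qValue β s u :=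
            M.measurable_bellmanQ β hc (M.measurable_value β hc) u
          simpa [Set.preimage, optimalAction_true_iff] using measurableSet_le (hQ true) (hQ false) }
    refine ⟨φ, fun e b => by simp [φ, h], M.isOptimal_of_forall_optimalAction β hc φ fun s => ?_⟩
    by_cases hs : M.OptimalAction β s true
    · have : φ.act s = true := decide_eq_true hs
      rwa [this]
    · have : φ.act s = false := decide_eq_false hs
      rw [this]
      rw [optimalAction_true_iff, not_le] at hs
      intro v
      cases v
      exacts [le_rfl, hs.le]
  · rw [← h, ← hb]
    exact M.optimalAction_of_isOptimal β hc φ hφ (e, b)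

end MDP

/-! ### Gaussian laws -/

lemma gaussianPDF_le_of_abs_le {m m' x : ℝ} (h : |x - m'| ≤ |x - m|) :
    gaussianPDF m 1 x ≤ gaussianPDF m' 1 x := by
  unfold gaussianPDF gaussianPDFReal
  have := sq_le_sq.2 h
  gcongr

lemma gaussianPDF_reflect (m m' x : ℝ) :
    gaussianPDF m 1 (m + m' - x) = gaussianPDF m' 1 x := by
  unfold gaussianPDF gaussianPDFReal
  rw [show (m + m' - x - m) = -(x - m') by ring, neg_sq]

lemma lintegral_gaussianReal (m : ℝ) {H : ℝ → ℝ≥0∞} (hH : Measurable H) :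
    ∫⁻ x, H x ∂(gaussianReal m 1) = ∫⁻ x, gaussianPDF m 1 x * H x := by
  rw [gaussianReal_of_var_ne_zero m one_ne_zero,
    lintegral_withDensity_eq_lintegral_mul _ (measurable_gaussianPDF m 1) hH]
  rfl

/-- The rearrangement inequality for two terms. -/
lemma ENNReal.mul_add_mul_le_of_le {a b c d : ℝ≥0∞} (hab : a ≤ b) (hcd : c ≤ d) :
    b * c + a * d ≤ a * c + b * d := by
  obtain ⟨k, rfl⟩ := exists_add_of_le hab
  have : k * c ≤ k * d := by gcongr
  calc (a + k) * c + a * d = a * c + a * d + k * c := by ring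
    _ ≤ a * c + a * d + k * d := by gcongr
    _ = a * c + (a + k) * d := by ring

lemma lintegral_gaussianReal_neg (m : ℝ) {H : ℝ → ℝ≥0∞} (hH : Measurable H)
    (heven : ∀ x, H (-x) = H x) :
    ∫⁻ x, H x ∂(gaussianReal (-m) 1) = ∫⁻ x, H x ∂(gaussianReal m 1) := by
  rw [← gaussianReal_map_neg, lintegral_map hH measurable_neg]
  simp_rw [heven]

lemma lintegral_gaussianReal_abs (m : ℝ) {H : ℝ → ℝ≥0∞} (hH : Measurable H)
    (heven : ∀ x, H (-x) = H x) :
    ∫⁻ x, H x ∂(gaussianReal |m| 1) = ∫⁻ x, H x ∂(gaussianReal m 1) := by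
  rcases abs_choice m with h | h <;> rw [h]
  exact lintegral_gaussianReal_neg m hH heven

/-- The modulus of a Gaussian variable with mean `m` is stochastically increasing in `m ≥ 0`. -/
lemma lintegral_gaussianReal_mono_of_nonneg {m m' : ℝ} (hm : 0 ≤ m) (hmm' : m ≤ m')
    {H : ℝ → ℝ≥0∞} (hH : Measurable H) (hmono : ∀ x y, |x| ≤ |y| → H x ≤ H y) :
    ∫⁻ x, H x ∂(gaussianReal m 1) ≤ ∫⁻ x, H x ∂(gaussianReal m' 1) := by
  rw [lintegral_gaussianReal m hH, lintegral_gaussianReal m' hH]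
  have hmeas (k : ℝ) : Measurable fun x => gaussianPDF k 1 x * H x :=
    (measurable_gaussianPDF k 1).mul hH
  -- Averaging over the reflection `x ↦ m + m' - x`, which exchanges the two densities, reduces the
  -- claim to a pointwise inequality.
  have hsym (k : ℝ) : ∫⁻ x, (gaussianPDF k 1 x * H x +
      gaussianPDF k 1 (m + m' - x) * H (m + m' - x)) = 2 * ∫⁻ x, gaussianPDF k 1 x * H x := by
    rw [lintegral_add_left (hmeas k),
      lintegral_sub_left_eq_self (fun x => gaussianPDF k 1 x * H x), two_mul]
  have h2 : 2 * ∫⁻ x, gaussianPDF m 1 x * H x ≤ 2 * ∫⁻ x, gaussianPDF m' 1 x * H x := by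
    rw [← hsym, ← hsym]
    refine lintegral_mono fun x => ?_
    have e1 := gaussianPDF_reflect m m' x
    have e2 : gaussianPDF m' 1 (m + m' - x) = gaussianPDF m 1 x := by
      rw [add_comm m, gaussianPDF_reflect]
    simp only [e1, e2]
    -- Of `x` and its reflection, the larger is nearer to `m'` and, as `m + m' ≥ 0`, has the larger
    -- modulus. The larger density thus meets the larger value of `H`, and rearrangement applies.
    rcases le_total (m + m') (2 * x) with h | h
    · rw [add_comm (gaussianPDF m 1 x * H x), add_comm (gaussianPDF m' 1 x * H x)]
      refine ENNReal.mul_add_mul_le_of_le (gaussianPDF_le_of_abs_le ?_) (hmono _ _ ?_)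
      · apply abs_le_abs <;> linarith
      · apply abs_le_abs <;> linarith
    · refine ENNReal.mul_add_mul_le_of_le (gaussianPDF_le_of_abs_le ?_) (hmono _ _ ?_)
      · rw [abs_sub_comm x, abs_sub_comm x]
        apply abs_le_abs <;> linarith
      · rw [abs_le, abs_of_nonneg (by linarith : 0 ≤ m + m' - x)]
        constructor <;> linarith
  exact (ENNReal.mul_le_mul_iff_right two_ne_zero ENNReal.ofNat_ne_top).1 h2

lemma lintegral_gaussianReal_mono {m m' : ℝ} (hmm' : |m| ≤ |m'|) {H : ℝ → ℝ≥0∞}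
    (hH : Measurable H) (hmono : ∀ x y, |x| ≤ |y| → H x ≤ H y) :
    ∫⁻ x, H x ∂(gaussianReal m 1) ≤ ∫⁻ x, H x ∂(gaussianReal m' 1) := by
  have heven (x : ℝ) : H (-x) = H x :=
    le_antisymm (hmono _ _ (abs_neg x).le) (hmono _ _ (abs_neg x).ge)
  rw [← lintegral_gaussianReal_abs m hH heven, ← lintegral_gaussianReal_abs m' hH heven]
  exact lintegral_gaussianReal_mono_of_nonneg (abs_nonneg m) hmm' hH hmono

lemma lintegral_gaussianReal_quadratic (m : ℝ) {k C : ℝ} (hk : 0 ≤ k) (hC : 0 ≤ C) :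
    ∫⁻ x, ENNReal.ofReal (x ^ 2 * k + C) ∂(gaussianReal m 1) =
      ENNReal.ofReal ((m ^ 2 + 1) * k + C) := by
  have hL : MemLp (fun x : ℝ => x) 2 (gaussianReal m 1) := memLp_id_gaussianReal 2
  have hi : Integrable (fun x : ℝ => x ^ 2) (gaussianReal m 1) := hL.integrable_sq
  have hv := variance_eq_sub hL
  rw [variance_fun_id_gaussianReal, integral_id_gaussianReal] at hv
  have h2 : ∫ x, x ^ 2 ∂(gaussianReal m 1) = m ^ 2 + 1 := by
    have : ∫ x, x ^ 2 ∂(gaussianReal m 1) = ∫ x, ((fun x : ℝ => x) ^ 2) x ∂(gaussianReal m 1) := rfl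
    rw [this]
    push_cast at hv
    linarith
  have hI : Integrable (fun x : ℝ => x ^ 2 * k + C) (gaussianReal m 1) :=
    (hi.mul_const k).add (integrable_const C)
  rw [← ofReal_integral_eq_lintegral_ofReal hI
    (Filter.Eventually.of_forall fun x => by positivity),
    integral_add (hi.mul_const k) (integrable_const C), integral_mul_const, h2]
  simp

/-! ### One stage of the belief recursion -/

/-- Costs to go at a fixed error: `c b` after no transmission at belief `b`, and `r` after a
successful transmission. A failed transmission leads to `c 0`. -/
structure BeliefStage (lam β r : ℝ) (c : I → ℝ) : Prop where
  lam_nonneg : 0 ≤ lam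
  disc_nonneg : 0 ≤ β
  disc_le_one : β ≤ 1
  reset_le : r ≤ c 1
  anti : Antitone c
  concave : ∀ x y z t : I, (z : ℝ) = t * x + (1 - t) * y → t * c x + (1 - t) * c y ≤ c z
  mix : ∀ x y z t : I, y ≤ x → (z : ℝ) = t * x + (1 - t) * y →
    c z ≤ (1 - t) * lam + t * c x + (1 - t) * c y

/-- For `y ≤ z ≤ x`, the point `z` is a convex combination of `x` and `y`. -/
lemma unitInterval.exists_convex_combination {x y z : I} (hyz : y ≤ z) (hzx : z ≤ x) :
    ∃ t : I, (z : ℝ) = t * x + (1 - t) * y ∧ (t : ℝ) * (x - y) = z - y := by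
  have h1 : (y : ℝ) ≤ z := hyz
  have h2 : (z : ℝ) ≤ x := hzx
  rcases (h1.trans h2).eq_or_lt with h | h
  · exact ⟨0, by simp; linarith, by simp; linarith⟩
  · have hpos : (0 : ℝ) < x - y := sub_pos.2 h
    refine ⟨⟨((z : ℝ) - y) / (x - y), div_nonneg (by linarith) hpos.le,
      (div_le_one hpos).2 (by linarith)⟩, ?_, ?_⟩
    · field_simp
      ring
    · exact div_mul_cancel₀ _ hpos.ne'

namespace BeliefStage

/-- The cost of transmitting. -/
def transmit (lam β r : ℝ) (c : I → ℝ) (b : I) : ℝ := lam + β * (b * r + (1 - b) * c 0)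

/-- The cost of the better action. -/
def best (lam β r : ℝ) (c : I → ℝ) (b : I) : ℝ := min (β * c b) (transmit lam β r c b)

variable {lam β r : ℝ} {c : I → ℝ}

lemma transmit_affine {x y z t : I} (h : (z : ℝ) = t * x + (1 - t) * y) :
    transmit lam β r c z = t * transmit lam β r c x + (1 - t) * transmit lam β r c y := by
  simp only [transmit, h]
  ring

lemma transmit_zero : transmit lam β r c 0 = lam + β * c 0 := by
  simp [transmit]

lemma transmit_one : transmit lam β r c 1 = lam + β * r := by
  simp [transmit]

/-- The difference is convex: an affine function minus a concave one. -/
lemma transmit_sub_le (h : BeliefStage lam β r c) {x y z t : I}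
    (hz : (z : ℝ) = t * x + (1 - t) * y) :
    transmit lam β r c z - β * c z ≤ t * (transmit lam β r c x - β * c x) +
      (1 - t) * (transmit lam β r c y - β * c y) := by
  have := mul_le_mul_of_nonneg_left (h.concave x y z t hz) h.disc_nonneg
  rw [transmit_affine hz]
  linarith

/-- If transmitting is no worse at some belief, then so it is at belief `1`. -/
lemma transmit_one_le (h : BeliefStage lam β r c) {y : I}
    (hy : transmit lam β r c y ≤ β * c y) : lam + β * r ≤ β * c 1 := by
  have hβ := h.disc_nonneg
  have hβ1 := h.disc_le_one
  have hl := h.lam_nonneg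
  have hr := mul_le_mul_of_nonneg_left h.reset_le hβ
  have hy0 : 0 ≤ (y : ℝ) := y.2.1
  have hy1 : 0 ≤ 1 - (y : ℝ) := sub_nonneg.2 y.2.2
  -- The belief `y` is the mixture of `1` and `0` with weight `y`. The terms in `c 0` cancel against
  -- those of `transmit`, and what remains is `y` times the claim.
  have hm := mul_le_mul_of_nonneg_left (h.mix 1 0 y y zero_le_one (by simp)) hβ
  unfold transmit at hy
  rcases hy0.eq_or_lt with h0 | h0
  · have : y = 0 := Subtype.ext h0.symm
    subst this
    simp at hy
    linarith
  · have hl2 : β * ((1 - y) * lam) ≤ (1 - y) * lam :=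
      mul_le_of_le_one_left (mul_nonneg hy1 hl) hβ1
    have : (y : ℝ) * (lam + β * r - β * c 1) ≤ 0 := by linarith
    by_contra! hlt
    have := mul_pos h0 (sub_pos.2 hlt)
    linarith

/-- If transmitting is no worse at some belief, then so it is at every larger belief. -/
lemma transmit_le_of_le (h : BeliefStage lam β r c) {x y : I} (hyx : y ≤ x)
    (hy : transmit lam β r c y ≤ β * c y) : transmit lam β r c x ≤ β * c x := by
  have h1 := h.transmit_one_le hy
  obtain ⟨t, ht, -⟩ := unitInterval.exists_convex_combination hyx (le_one' : x ≤ 1)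
  have h2 := h.transmit_sub_le ht
  rw [transmit_one] at h2
  have h3 : t * (lam + β * r - β * c 1) ≤ 0 :=
    mul_nonpos_of_nonneg_of_nonpos t.2.1 (by linarith)
  have h4 : (1 - t) * (transmit lam β r c y - β * c y) ≤ 0 :=
    mul_nonpos_of_nonneg_of_nonpos (sub_nonneg.2 t.2.2) (by linarith)
  linarith

/-- The set of beliefs at which transmitting is no worse contains its infimum. -/
lemma transmit_le_of_forall_gt (h : BeliefStage lam β r c) {b : I} (hb1 : b < 1)
    (hb : ∀ s, b < s → transmit lam β r c s ≤ β * c s) : transmit lam β r c b ≤ β * c b := by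
  have hl := h.lam_nonneg
  have hβ := h.disc_nonneg
  have hb0 : 0 ≤ (b : ℝ) := b.2.1
  have hb1' : (b : ℝ) < 1 := hb1
  -- Beliefs just above `b`. The denominator `K + 1` allows `K = 0`, and the minimum with `1 - b`
  -- keeps `s` in the unit interval.
  have approach {K ε : ℝ} (hK : 0 ≤ K) (hε : 0 < ε) : ∃ s : I, b < s ∧ (s - b) * K < ε := by
    have hp : 0 < min (1 - (b : ℝ)) (ε / (K + 1)) := lt_min (by linarith) (by positivity)
    refine ⟨⟨b + min (1 - (b : ℝ)) (ε / (K + 1)), by linarith,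
      by linarith [min_le_left (1 - (b : ℝ)) (ε / (K + 1))]⟩, ?_, ?_⟩
    · change (b : ℝ) < b + min (1 - (b : ℝ)) (ε / (K + 1))
      linarith
    · simp only [add_sub_cancel_left]
      calc min (1 - (b : ℝ)) (ε / (K + 1)) * K ≤ ε / (K + 1) * K := by
            gcongr
            exact min_le_right _ _
        _ < ε / (K + 1) * (K + 1) := by
            gcongr
            linarith
        _ = ε := div_mul_cancel₀ _ (by positivity)
  by_contra! hlt
  rcases hb0.eq_or_lt with h0 | h0
  · have hb' : b = 0 := Subtype.ext h0.symm
    subst hb'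
    rw [transmit_zero] at hlt
    -- At `b = 0` the excess cost of transmitting is `lam`. For small `s`, monotonicity of `c` gives
    -- `lam ≤ s * β * (c 0 - r)`, which is impossible if `lam > 0`.
    have hr : r ≤ c 0 := h.reset_le.trans (h.anti zero_le_one)
    obtain ⟨s, hs, hs2⟩ := approach (K := β * (c 0 - r))
      (mul_nonneg hβ (sub_nonneg.2 hr)) (by linarith : 0 < lam)
    have h1 := hb s hs
    have h2 := mul_le_mul_of_nonneg_left (h.anti hs.le) hβ
    simp only [transmit, Set.Icc.coe_zero] at h1 hs2
    linarith
  -- Convexity between `0`, where the excess is `lam`, and `s`, where it is at most `0`, bounds the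
  -- excess at `b` by `(1 - b / s) * lam`, which is small for `s` near `b`.
  · obtain ⟨s, hs, hs2⟩ := approach hl (mul_pos h0 (sub_pos.2 hlt))
    have hs' : (b : ℝ) < s := hs
    obtain ⟨t, ht, ht2⟩ := unitInterval.exists_convex_combination (nonneg' : 0 ≤ b) hs.le
    have h1 := h.transmit_sub_le ht
    rw [transmit_zero] at h1
    simp only [Set.Icc.coe_zero, sub_zero] at ht2
    have h2 : t * (transmit lam β r c s - β * c s) ≤ 0 :=
      mul_nonpos_of_nonneg_of_nonpos t.2.1 (by linarith [hb s hs])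
    have h3 : transmit lam β r c b - β * c b ≤ (1 - t) * lam := by linarith
    have h4 : s * (transmit lam β r c b - β * c b) ≤ s * ((1 - t) * lam) :=
      mul_le_mul_of_nonneg_left h3 s.2.1
    have h5 : s * ((1 - t) * lam) = (s - b) * lam := by
      rw [← ht2]
      ring
    have h6 : b * (transmit lam β r c b - β * c b) ≤ s * (transmit lam β r c b - β * c b) :=
      mul_le_mul_of_nonneg_right hs'.le (by linarith)
    linarith

/-- Transmitting is no worse exactly above a threshold. -/
lemma exists_threshold (h : BeliefStage lam β r c) :
    ∃ θ : ℝ, ∀ b : I, transmit lam β r c b ≤ β * c b ↔ θ ≤ b := by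
  set A : Set ℝ := {x | ∃ b : I, transmit lam β r c b ≤ β * c b ∧ (b : ℝ) = x} with hA
  rcases A.eq_empty_or_nonempty with hE | hN
  -- Any number above `1` encodes that transmitting is never optimal.
  · refine ⟨2, fun b => ⟨fun hb => ?_, fun hb => ?_⟩⟩
    · have : (b : ℝ) ∈ A := ⟨b, hb, rfl⟩
      simp [hE] at this
    · linarith [b.2.2]
  · have hbdd : BddBelow A := ⟨0, by rintro _ ⟨b, -, rfl⟩; exact b.2.1⟩
    refine ⟨sInf A, fun b => ⟨fun hb => csInf_le hbdd ⟨b, hb, rfl⟩, fun hb => ?_⟩⟩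
    have above (s : I) (hs : b < s) : transmit lam β r c s ≤ β * c s := by
      obtain ⟨_, ⟨y, hy, rfl⟩, hlt⟩ := exists_lt_of_csInf_lt hN (lt_of_le_of_lt hb hs)
      exact h.transmit_le_of_le (le_of_lt hlt) hy
    -- At `b = 1` there is no belief above to approach from, but `1` lies above any element of the
    -- nonempty set `A`.
    rcases (le_one' : b ≤ 1).eq_or_lt with h1 | h1
    · obtain ⟨_, y, hy, rfl⟩ := hN
      exact h.transmit_le_of_le (h1 ▸ le_one') hy
    · exact h.transmit_le_of_forall_gt h1 above

lemma transmit_anti (h : BeliefStage lam β r c) : Antitone (transmit lam β r c) := by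
  intro x y hxy
  have hr : r ≤ c 0 := h.reset_le.trans (h.anti zero_le_one)
  have hxy' : (x : ℝ) ≤ y := hxy
  have := mul_nonneg h.disc_nonneg (mul_nonneg (sub_nonneg.2 hxy') (sub_nonneg.2 hr))
  unfold transmit
  linarith

lemma best_anti (h : BeliefStage lam β r c) : Antitone (best lam β r c) := fun _ _ hxy =>
  min_le_min (mul_le_mul_of_nonneg_left (h.anti hxy) h.disc_nonneg) (h.transmit_anti hxy)

lemma best_concave (h : BeliefStage lam β r c) {x y z t : I}
    (hz : (z : ℝ) = t * x + (1 - t) * y) :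
    t * best lam β r c x + (1 - t) * best lam β r c y ≤ best lam β r c z := by
  have ht : 0 ≤ (t : ℝ) := t.2.1
  have ht' : 0 ≤ 1 - (t : ℝ) := sub_nonneg.2 t.2.2
  refine le_min ?_ ?_
  · have h1 := mul_le_mul_of_nonneg_left (h.concave x y z t hz) h.disc_nonneg
    have h2 := mul_le_mul_of_nonneg_left (min_le_left (β * c x) (transmit lam β r c x)) ht
    have h3 := mul_le_mul_of_nonneg_left (min_le_left (β * c y) (transmit lam β r c y)) ht'
    unfold best
    linarith
  · rw [transmit_affine hz]
    have h2 := mul_le_mul_of_nonneg_left (min_le_right (β * c x) (transmit lam β r c x)) ht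
    have h3 := mul_le_mul_of_nonneg_left (min_le_right (β * c y) (transmit lam β r c y)) ht'
    unfold best
    linarith

/-- Transmitting costs at most the price `lam` more than not transmitting. -/
lemma transmit_le_lam_add (h : BeliefStage lam β r c) (b : I) :
    transmit lam β r c b ≤ lam + β * c b := by
  have h1 := h.concave 1 0 b b (by simp)
  have h2 := mul_le_mul_of_nonneg_left h.reset_le b.2.1
  have := mul_le_mul_of_nonneg_left (by linarith : b * r + (1 - b) * c 0 ≤ c b) h.disc_nonneg
  unfold transmit
  linarith

/-- If transmitting is best at `x`, transmit at `z` too: that cost is affine and exceeds the best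
cost at `y` by at most `lam`. Otherwise the threshold property makes waiting best at `y` as well,
and `mix` for `c` applies, with `β ≤ 1` absorbing the discount on `lam`. -/
lemma best_mix (h : BeliefStage lam β r c) {x y z t : I} (hyx : y ≤ x)
    (hz : (z : ℝ) = t * x + (1 - t) * y) :
    best lam β r c z ≤ (1 - t) * lam + t * best lam β r c x + (1 - t) * best lam β r c y := by
  have hl := h.lam_nonneg
  have ht : 0 ≤ (t : ℝ) := t.2.1
  have ht' : 0 ≤ 1 - (t : ℝ) := sub_nonneg.2 t.2.2
  have hlt := mul_nonneg ht' hl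
  have haff := transmit_affine (lam := lam) (β := β) (r := r) (c := c) hz
  have hz1 : best lam β r c z ≤ transmit lam β r c z := min_le_right _ _
  by_cases hx : transmit lam β r c x ≤ β * c x
  · have hbx : best lam β r c x = transmit lam β r c x := min_eq_right hx
    have hy : transmit lam β r c y ≤ lam + best lam β r c y := by
      unfold best
      rcases min_choice (β * c y) (transmit lam β r c y) with e | e <;> rw [e]
      · exact h.transmit_le_lam_add y
      · linarith
    have := mul_le_mul_of_nonneg_left hy ht'
    rw [hbx]
    linarith
  · have hy : ¬ transmit lam β r c y ≤ β * c y := fun hy => hx (h.transmit_le_of_le hyx hy)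
    have hbx : best lam β r c x = β * c x := min_eq_left (not_le.1 hx).le
    have hby : best lam β r c y = β * c y := min_eq_left (not_le.1 hy).le
    have h1 := mul_le_mul_of_nonneg_left (h.mix x y z t hyx hz) h.disc_nonneg
    have h2 : best lam β r c z ≤ β * c z := min_le_left _ _
    have h3 : β * ((1 - t) * lam) ≤ (1 - t) * lam := mul_le_of_le_one_left hlt h.disc_le_one
    rw [hbx, hby]
    linarith

end BeliefStage

/-! ### The scheduling problem -/

section Schedule

variable {E : Type} [MeasurableSpace E] (err : Kernel ℝ E) [IsMarkovKernel err]
  (val : E → ℝ) (hval : Measurable val) (a lam : ℝ) (p01 p11 : I)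

lemma measurable_scheduleMDP_cost (u : Bool) :
    Measurable fun s => (scheduleMDP err val hval a lam p01 p11).cost s u := by
  change Measurable fun s : E × I => ENNReal.ofReal (val s.1 ^ 2 + lam * (if u = true then 1 else 0))
  fun_prop

lemma lintegral_prod_dirac_belief (m : ℝ) (b : I) {v : E × I → ℝ≥0∞} (hv : Measurable v) :
    ∫⁻ s, v s ∂((err m).prod (Measure.dirac b)) = ∫⁻ x, v (x, b) ∂(err m) := by
  rw [Measure.prod_dirac, lintegral_map hv (by fun_prop)]

lemma scheduleMDP_bellmanQ_false (β : ℝ) {v : E × I → ℝ≥0∞} (hv : Measurable v) (e : E) (b : I) :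
    (scheduleMDP err val hval a lam p01 p11).bellmanQ β v (e, b) false =
      ENNReal.ofReal (val e ^ 2) +
        ENNReal.ofReal β * ∫⁻ x, v (x, beliefUpdate p01 p11 b) ∂(err (a * val e)) := by
  have h : (scheduleMDP err val hval a lam p01 p11).trans ((e, b), false) =
      (err (a * val e)).prod (Measure.dirac (beliefUpdate p01 p11 b)) := by
    change scheduleLaw err val a p01 p11 ((e, b), false) = _
    simp [scheduleLaw]
  rw [MDP.bellmanQ, h, lintegral_prod_dirac_belief err _ _ hv]
  simp [scheduleMDP]

lemma scheduleMDP_bellmanQ_true (β : ℝ) {v : E × I → ℝ≥0∞} (hv : Measurable v) (e : E) (b : I) :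
    (scheduleMDP err val hval a lam p01 p11).bellmanQ β v (e, b) true =
      ENNReal.ofReal (val e ^ 2 + lam) +
        ENNReal.ofReal β * (ENNReal.ofReal b * ∫⁻ x, v (x, p11) ∂(err 0) +
          ENNReal.ofReal (1 - b) * ∫⁻ x, v (x, p01) ∂(err (a * val e))) := by
  have h : (scheduleMDP err val hval a lam p01 p11).trans ((e, b), true) =
      ENNReal.ofReal (b : ℝ) • (err 0).prod (Measure.dirac p11) +
      ENNReal.ofReal (1 - (b : ℝ)) • (err (a * val e)).prod (Measure.dirac p01) := by
    change scheduleLaw err val a p01 p11 ((e, b), true) = _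
    simp [scheduleLaw]
  rw [MDP.bellmanQ, h, lintegral_add_measure, lintegral_smul_measure, lintegral_smul_measure,
    lintegral_prod_dirac_belief err _ _ hv, lintegral_prod_dirac_belief err _ _ hv]
  simp [scheduleMDP]

end Schedule

/-! ### The belief map and the invariant of value iteration -/

lemma beliefUpdate_zero (p01 p11 : I) : beliefUpdate p01 p11 0 = p01 := by
  ext
  simp [beliefUpdate]

lemma beliefUpdate_one (p01 p11 : I) : beliefUpdate p01 p11 1 = p11 := by
  ext
  simp [beliefUpdate]

lemma monotone_beliefUpdate {p01 p11 : I} (hp : p01 ≤ p11) : Monotone (beliefUpdate p01 p11) := by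
  intro x y hxy
  have h1 : (p01 : ℝ) ≤ p11 := hp
  have h2 : (x : ℝ) ≤ y := hxy
  change (x : ℝ) * p11 + (1 - x) * p01 ≤ y * p11 + (1 - y) * p01
  linarith [mul_nonneg (sub_nonneg.2 h2) (sub_nonneg.2 h1)]

lemma beliefUpdate_affine (p01 p11 : I) {x y z t : I} (h : (z : ℝ) = t * x + (1 - t) * y) :
    (beliefUpdate p01 p11 z : ℝ) =
      t * beliefUpdate p01 p11 x + (1 - t) * beliefUpdate p01 p11 y := by
  simp only [beliefUpdate, h]
  ring

/-- The expectation of `v (x, b)` when `x` is Gaussian with mean `m`. -/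
def gaussianMean (v : ℝ × I → ℝ≥0∞) (m : ℝ) (b : I) : ℝ≥0∞ :=
  ∫⁻ x, v (x, b) ∂(gaussianReal m 1)

/-- The structural properties that value iteration preserves. -/
structure StructuredValue (lam : ℝ) (v : ℝ × I → ℝ≥0∞) : Prop where
  measurable : Measurable v
  abs_mono : ∀ (b : I) (e e' : ℝ), |e| ≤ |e'| → v (e, b) ≤ v (e', b)
  belief_anti : ∀ (e : ℝ) (b b' : I), b ≤ b' → v (e, b') ≤ v (e, b)
  concave : ∀ (e : ℝ) (x y z t : I), (z : ℝ) = t * x + (1 - t) * y →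
    ENNReal.ofReal t * v (e, x) + ENNReal.ofReal (1 - t) * v (e, y) ≤ v (e, z)
  mix : ∀ (e : ℝ) (x y z t : I), y ≤ x → (z : ℝ) = t * x + (1 - t) * y →
    v (e, z) ≤ ENNReal.ofReal ((1 - t) * lam) + ENNReal.ofReal t * v (e, x) +
      ENNReal.ofReal (1 - t) * v (e, y)

lemma ENNReal.ofReal_convex {t p q : ℝ} (ht0 : 0 ≤ t) (ht1 : t ≤ 1) (hp : 0 ≤ p) (hq : 0 ≤ q) :
    ENNReal.ofReal t * ENNReal.ofReal p + ENNReal.ofReal (1 - t) * ENNReal.ofReal q =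
      ENNReal.ofReal (t * p + (1 - t) * q) := by
  rw [← ENNReal.ofReal_mul ht0, ← ENNReal.ofReal_mul (sub_nonneg.2 ht1),
    ← ENNReal.ofReal_add (mul_nonneg ht0 hp) (mul_nonneg (sub_nonneg.2 ht1) hq)]

namespace StructuredValue

variable {lam : ℝ} {v : ℝ × I → ℝ≥0∞}

lemma gaussianMean_abs_mono (h : StructuredValue lam v) {m m' : ℝ} (hm : |m| ≤ |m'|) (b : I) :
    gaussianMean v m b ≤ gaussianMean v m' b :=
  lintegral_gaussianReal_mono hm (h.measurable.comp (by fun_prop)) (h.abs_mono b)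

lemma gaussianMean_concave (h : StructuredValue lam v) (m : ℝ) {x y z t : I}
    (hz : (z : ℝ) = t * x + (1 - t) * y) :
    ENNReal.ofReal t * gaussianMean v m x + ENNReal.ofReal (1 - t) * gaussianMean v m y ≤
      gaussianMean v m z := by
  have hm (b : I) : Measurable fun e => v (e, b) := h.measurable.comp (by fun_prop)
  unfold gaussianMean
  rw [← lintegral_const_mul _ (hm x), ← lintegral_const_mul _ (hm y),
    ← lintegral_add_left ((hm x).const_mul _)]
  exact lintegral_mono fun e => h.concave e x y z t hz

lemma gaussianMean_mix (h : StructuredValue lam v) (m : ℝ) {x y z t : I} (hyx : y ≤ x)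
    (hz : (z : ℝ) = t * x + (1 - t) * y) :
    gaussianMean v m z ≤ ENNReal.ofReal ((1 - t) * lam) + ENNReal.ofReal t * gaussianMean v m x +
      ENNReal.ofReal (1 - t) * gaussianMean v m y := by
  have hm (b : I) : Measurable fun e => v (e, b) := h.measurable.comp (by fun_prop)
  have hmx : Measurable fun e =>
      ENNReal.ofReal ((1 - t) * lam) + ENNReal.ofReal t * v (e, x) :=
    measurable_const.add ((hm x).const_mul _)
  unfold gaussianMean
  have h1 : ENNReal.ofReal ((1 - t) * lam) =
      ∫⁻ _, ENNReal.ofReal ((1 - t) * lam) ∂(gaussianReal m 1) := by simp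
  rw [h1, ← lintegral_const_mul _ (hm x), ← lintegral_const_mul _ (hm y),
    ← lintegral_add_left measurable_const, ← lintegral_add_left hmx]
  exact lintegral_mono fun e => h.mix e x y z t hyx hz

/-- The costs to go at a fixed error, as real numbers. -/
lemma beliefStage (h : StructuredValue lam v) {β : ℝ} (hlam : 0 ≤ lam) (hβ0 : 0 ≤ β) (hβ1 : β ≤ 1)
    {p01 p11 : I} (hp : p01 ≤ p11) (hfin : ∀ m b, gaussianMean v m b ≠ ∞) (m : ℝ) :
    BeliefStage lam β (gaussianMean v 0 p11).toReal
      (fun b => (gaussianMean v m (beliefUpdate p01 p11 b)).toReal) where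
  lam_nonneg := hlam
  disc_nonneg := hβ0
  disc_le_one := hβ1
  reset_le := by
    -- Both sides now have belief `p11`, and mean `0` has the least modulus.
    rw [beliefUpdate_one]
    exact ENNReal.toReal_mono (hfin _ _) (h.gaussianMean_abs_mono (by simp) _)
  anti b b' hb := ENNReal.toReal_mono (hfin _ _) (lintegral_mono fun e =>
    h.belief_anti e _ _ (monotone_beliefUpdate hp hb))
  concave x y z t hz := by
    have key := h.gaussianMean_concave m (beliefUpdate_affine p01 p11 hz)
    rw [← ENNReal.ofReal_toReal (hfin m (beliefUpdate p01 p11 x)),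
      ← ENNReal.ofReal_toReal (hfin m (beliefUpdate p01 p11 y)),
      ← ENNReal.ofReal_toReal (hfin m (beliefUpdate p01 p11 z)),
      ENNReal.ofReal_convex t.2.1 t.2.2 ENNReal.toReal_nonneg ENNReal.toReal_nonneg] at key
    exact (ENNReal.ofReal_le_ofReal_iff ENNReal.toReal_nonneg).1 key
  mix x y z t hyx hz := by
    have key := h.gaussianMean_mix m (monotone_beliefUpdate hp hyx) (beliefUpdate_affine p01 p11 hz)
    have ht : 0 ≤ 1 - (t : ℝ) := sub_nonneg.2 t.2.2
    have hc : 0 ≤ t * (gaussianMean v m (beliefUpdate p01 p11 x)).toReal +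
        (1 - t) * (gaussianMean v m (beliefUpdate p01 p11 y)).toReal :=
      add_nonneg (mul_nonneg t.2.1 ENNReal.toReal_nonneg) (mul_nonneg ht ENNReal.toReal_nonneg)
    rw [← ENNReal.ofReal_toReal (hfin m (beliefUpdate p01 p11 x)),
      ← ENNReal.ofReal_toReal (hfin m (beliefUpdate p01 p11 y)),
      ← ENNReal.ofReal_toReal (hfin m (beliefUpdate p01 p11 z)), add_assoc,
      ENNReal.ofReal_convex t.2.1 t.2.2 ENNReal.toReal_nonneg ENNReal.toReal_nonneg,
      ← ENNReal.ofReal_add (mul_nonneg ht hlam) hc,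
      ENNReal.ofReal_le_ofReal_iff (add_nonneg (mul_nonneg ht hlam) hc)] at key
    linarith

variable (a : ℝ) {p01 p11 : I}

lemma bellmanQ_false_eq (h : StructuredValue lam v) {β : ℝ} (hβ0 : 0 ≤ β)
    (hfin : ∀ m b, gaussianMean v m b ≠ ∞) (e : ℝ) (b : I) :
    (originalPOMDP a lam p01 p11).bellmanQ β v (e, b) false =
      ENNReal.ofReal (e ^ 2 + β * (gaussianMean v (a * e) (beliefUpdate p01 p11 b)).toReal) := by
  rw [originalPOMDP, scheduleMDP_bellmanQ_false _ _ _ _ _ _ _ _ h.measurable,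
    ENNReal.ofReal_add (sq_nonneg e) (mul_nonneg hβ0 ENNReal.toReal_nonneg),
    ENNReal.ofReal_mul hβ0, ENNReal.ofReal_toReal (hfin _ _)]
  rfl

lemma bellmanQ_true_eq (h : StructuredValue lam v) {β : ℝ} (hlam : 0 ≤ lam) (hβ0 : 0 ≤ β)
    (hfin : ∀ m b, gaussianMean v m b ≠ ∞) (e : ℝ) (b : I) :
    (originalPOMDP a lam p01 p11).bellmanQ β v (e, b) true =
      ENNReal.ofReal (e ^ 2 + BeliefStage.transmit lam β (gaussianMean v 0 p11).toReal
        (fun b => (gaussianMean v (a * e) (beliefUpdate p01 p11 b)).toReal) b) := by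
  rw [originalPOMDP, scheduleMDP_bellmanQ_true _ _ _ _ _ _ _ _ h.measurable]
  change _ + _ * (_ * gaussianMean v 0 p11 + _ * gaussianMean v (a * e) p01) = _
  have hc : 0 ≤ b * (gaussianMean v 0 p11).toReal + (1 - b) * (gaussianMean v (a * e) p01).toReal :=
    add_nonneg (mul_nonneg b.2.1 ENNReal.toReal_nonneg)
      (mul_nonneg (sub_nonneg.2 b.2.2) ENNReal.toReal_nonneg)
  rw [← ENNReal.ofReal_toReal (hfin 0 p11), ← ENNReal.ofReal_toReal (hfin (a * e) p01),
    ENNReal.ofReal_convex b.2.1 b.2.2 ENNReal.toReal_nonneg ENNReal.toReal_nonneg,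
    ← ENNReal.ofReal_mul hβ0, ← ENNReal.ofReal_add (by positivity) (mul_nonneg hβ0 hc),
    BeliefStage.transmit, beliefUpdate_zero, ENNReal.toReal_ofReal ENNReal.toReal_nonneg, add_assoc]
  rfl

lemma bellman_eq (h : StructuredValue lam v) {β : ℝ} (hlam : 0 ≤ lam) (hβ0 : 0 ≤ β)
    (hfin : ∀ m b, gaussianMean v m b ≠ ∞) (e : ℝ) (b : I) :
    (originalPOMDP a lam p01 p11).bellman β v (e, b) =
      ENNReal.ofReal (e ^ 2 + BeliefStage.best lam β (gaussianMean v 0 p11).toReal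
        (fun b => (gaussianMean v (a * e) (beliefUpdate p01 p11 b)).toReal) b) := by
  rw [MDP.bellman, h.bellmanQ_false_eq a hβ0 hfin, h.bellmanQ_true_eq a hlam hβ0 hfin,
    BeliefStage.best, ← min_add_add_left, ENNReal.ofReal_min]

/-- The Bellman operator preserves the structural properties. -/
lemma bellman (h : StructuredValue lam v) {β : ℝ} (hlam : 0 ≤ lam) (hβ0 : 0 ≤ β) (hβ1 : β ≤ 1)
    (hp : p01 ≤ p11) (hfin : ∀ m b, gaussianMean v m b ≠ ∞) :
    StructuredValue lam ((originalPOMDP a lam p01 p11).bellman β v) := by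
  have stage (e : ℝ) := h.beliefStage hlam hβ0 hβ1 hp hfin (a * e)
  have nonneg (e : ℝ) (b : I) : 0 ≤ e ^ 2 + BeliefStage.best lam β (gaussianMean v 0 p11).toReal
      (fun b => (gaussianMean v (a * e) (beliefUpdate p01 p11 b)).toReal) b := by
    have h1 : 0 ≤ 1 - (b : ℝ) := sub_nonneg.2 b.2.2
    have h0 : 0 ≤ (b : ℝ) := b.2.1
    refine add_nonneg (sq_nonneg e) (le_min ?_ ?_)
    · positivity
    · unfold BeliefStage.transmit
      positivity
  refine ⟨?_, ?_, ?_, ?_, ?_⟩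
  · exact MDP.measurable_bellman _ β (measurable_scheduleMDP_cost _ _ _ _ _ _ _) h.measurable
  · intro b e e' he
    have he2 : e ^ 2 ≤ e' ^ 2 := sq_le_sq.2 he
    have hJ (b : I) : gaussianMean v (a * e) b ≤ gaussianMean v (a * e') b := by
      refine h.gaussianMean_abs_mono ?_ b
      rw [abs_mul, abs_mul]
      gcongr
    have hJ' (b : I) : ∫⁻ x, v (x, b) ∂(gaussianErr (a * id e)) ≤
      ∫⁻ x, v (x, b) ∂(gaussianErr (a * id e')) := hJ b
    -- Monotonicity in the error holds for each action separately.
    refine min_le_min ?_ ?_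
    · rw [originalPOMDP, scheduleMDP_bellmanQ_false _ _ _ _ _ _ _ _ h.measurable,
        scheduleMDP_bellmanQ_false _ _ _ _ _ _ _ _ h.measurable]
      gcongr ?_ + _ * ?_
      · exact ENNReal.ofReal_le_ofReal he2
      · exact hJ' _
    · rw [originalPOMDP, scheduleMDP_bellmanQ_true _ _ _ _ _ _ _ _ h.measurable,
        scheduleMDP_bellmanQ_true _ _ _ _ _ _ _ _ h.measurable]
      gcongr ?_ + _ * (_ + _ * ?_)
      · exact ENNReal.ofReal_le_ofReal (by simpa using he2)
      · exact hJ' _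
  · intro e b b' hb
    rw [h.bellman_eq a hlam hβ0 hfin, h.bellman_eq a hlam hβ0 hfin]
    exact ENNReal.ofReal_le_ofReal (by linarith [(stage e).best_anti hb])
  · intro e x y z t hz
    rw [h.bellman_eq a hlam hβ0 hfin, h.bellman_eq a hlam hβ0 hfin, h.bellman_eq a hlam hβ0 hfin,
      ENNReal.ofReal_convex t.2.1 t.2.2 (nonneg e x) (nonneg e y)]
    exact ENNReal.ofReal_le_ofReal (by linarith [(stage e).best_concave hz])
  · intro e x y z t hyx hz
    have ht : 0 ≤ 1 - (t : ℝ) := sub_nonneg.2 t.2.2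
    rw [h.bellman_eq a hlam hβ0 hfin, h.bellman_eq a hlam hβ0 hfin, h.bellman_eq a hlam hβ0 hfin,
      add_assoc, ENNReal.ofReal_convex t.2.1 t.2.2 (nonneg e x) (nonneg e y),
      ← ENNReal.ofReal_add (mul_nonneg ht hlam)
        (add_nonneg (mul_nonneg t.2.1 (nonneg e x)) (mul_nonneg ht (nonneg e y)))]
    exact ENNReal.ofReal_le_ofReal (by linarith [(stage e).best_mix hyx hz])

lemma zero (lam : ℝ) : StructuredValue lam (fun _ => 0) where
  measurable := measurable_const
  abs_mono := by simp
  belief_anti := by simp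
  concave := by simp
  mix := by simp

/-- Monotonicity of the sequence serves only concavity, where a sum of two suprema must become one
supremum. -/
lemma iSup {v : ℕ → ℝ × I → ℝ≥0∞} (h : ∀ n, StructuredValue lam (v n)) (hmono : Monotone v) :
    StructuredValue lam (fun s => ⨆ n, v n s) where
  measurable := Measurable.iSup fun n => (h n).measurable
  abs_mono b e e' he := iSup_mono fun n => (h n).abs_mono b e e' he
  belief_anti e b b' hb := iSup_mono fun n => (h n).belief_anti e b b' hb
  concave e x y z t hz := by
    have hm (p : ℝ≥0∞) (s : ℝ × I) : Monotone fun n => p * v n s := fun i j hij => by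
      have := hmono hij s
      dsimp only
      gcongr
    rw [ENNReal.mul_iSup, ENNReal.mul_iSup, ENNReal.iSup_add_iSup_of_monotone (hm _ _) (hm _ _)]
    exact iSup_mono fun n => (h n).concave e x y z t hz
  mix e x y z t hyx hz := by
    refine iSup_le fun n => ((h n).mix e x y z t hyx hz).trans ?_
    gcongr
    · exact le_iSup (fun n => v n (e, x)) n
    · exact le_iSup (fun n => v n (e, y)) n

end StructuredValue

/-- The value function is finite: the quadratic bound is preserved by the policy that always
transmits. -/
lemma exists_valueIter_bound (a lam β : ℝ) (p01 p11 : I)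
    (hlam : 0 ≤ lam) (hβ0 : 0 < β) (hβ1 : β < 1) (hp : p01 ≤ p11)
    (hstab : a ^ 2 * (1 - (p01 : ℝ)) < 1) :
    ∃ κ C : ℝ, 0 ≤ κ ∧ 0 ≤ C ∧ ∀ (n : ℕ) (e : ℝ) (b : I),
      (originalPOMDP a lam p01 p11).valueIter β n (e, b) ≤
        ENNReal.ofReal (e ^ 2 * (1 + κ * (1 - b)) + C) := by
  have hq0 : 0 ≤ 1 - (p01 : ℝ) := sub_nonneg.2 p01.2.2
  have hd : 0 < 1 - β * (a ^ 2 * (1 - p01)) := by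
    have : β * (a ^ 2 * (1 - p01)) ≤ 1 * (a ^ 2 * (1 - p01)) := by gcongr
    linarith
  -- `g` is the coefficient of `e ^ 2` in the bound at belief `p01`, where a failed transmission
  -- leads. The equation makes the coefficient reproduce itself; it is solvable as `β * a ^ 2 * (1 -
  -- p01) < 1`.
  obtain ⟨g, hg0, hg⟩ : ∃ g : ℝ, 0 < g ∧ 1 + β * a ^ 2 * g * (1 - p01) = g := by
    refine ⟨(1 - β * (a ^ 2 * (1 - p01)))⁻¹, by positivity, ?_⟩
    linear_combination -(inv_mul_cancel₀ hd.ne')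
  -- The constant balances the price `lam`, the noise variance weighted by at most `g`, and its own
  -- discounted value.
  obtain ⟨C, hC0, hC⟩ : ∃ C : ℝ, 0 ≤ C ∧ lam + β * g + β * C = C := by
    have h1 : 0 < 1 - β := sub_pos.2 hβ1
    refine ⟨(lam + β * g) / (1 - β), by positivity, ?_⟩
    field_simp
    ring
  set κ : ℝ := β * a ^ 2 * g with hκ
  have hκ0 : 0 ≤ κ := by positivity
  have hk (b : I) : 0 ≤ 1 + κ * (1 - b) :=
    add_nonneg zero_le_one (mul_nonneg hκ0 (sub_nonneg.2 b.2.2))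
  refine ⟨κ, C, hκ0, hC0, fun n => ?_⟩
  induction n with
  | zero => exact fun e b => zero_le
  | succ n ih =>
    intro e b
    set W : ℝ × I → ℝ≥0∞ := fun s => ENNReal.ofReal (s.1 ^ 2 * (1 + κ * (1 - s.2)) + C) with hW
    have hWm : Measurable W := by fun_prop
    have hint (m : ℝ) (b : I) : ∫⁻ x, W (x, b) ∂(gaussianErr m) =
        ENNReal.ofReal ((m ^ 2 + 1) * (1 + κ * (1 - b)) + C) :=
      lintegral_gaussianReal_quadratic m (hk b) hC0
    have h1 : (originalPOMDP a lam p01 p11).valueIter β (n + 1) (e, b) ≤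
        (originalPOMDP a lam p01 p11).bellmanQ β W (e, b) true := by
      have h0 (s : ℝ × I) : (originalPOMDP a lam p01 p11).valueIter β n s ≤ W s := ih s.1 s.2
      rw [MDP.valueIter]
      exact (MDP.bellman_mono _ β h0 (e, b)).trans (MDP.bellman_le_bellmanQ _ β W (e, b) true)
    refine h1.trans ?_
    have hb0 : 0 ≤ (b : ℝ) := b.2.1
    have hb1 : 0 ≤ 1 - (b : ℝ) := sub_nonneg.2 b.2.2
    have hn (m : ℝ) (b : I) : 0 ≤ (m ^ 2 + 1) * (1 + κ * (1 - b)) + C :=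
      add_nonneg (mul_nonneg (by positivity) (hk b)) hC0
    rw [originalPOMDP, scheduleMDP_bellmanQ_true _ _ _ _ _ _ _ _ hWm, hint, hint,
      ENNReal.ofReal_convex hb0 b.2.2 (hn _ _) (hn _ _), ← ENNReal.ofReal_mul hβ0.le,
      ← ENNReal.ofReal_add (by positivity)
        (mul_nonneg hβ0.le (add_nonneg (mul_nonneg hb0 (hn _ _)) (mul_nonneg hb1 (hn _ _))))]
    refine ENNReal.ofReal_le_ofReal ?_
    -- After a success the coefficient is no larger than after a failure, because `p01 ≤ p11`.
    have hg1 : 1 + κ * (1 - p11) ≤ g := by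
      have h2 : (p01 : ℝ) ≤ p11 := hp
      have : κ * (1 - (p11 : ℝ)) ≤ κ * (1 - p01) := by gcongr
      linarith
    have h3 : β * (b * (1 + κ * (1 - p11))) ≤ β * (b * g) := by gcongr
    simp only [id_eq, hg]
    have h4 : e ^ 2 * (1 + κ * (1 - b)) = e ^ 2 + β * (1 - b) * (a * e) ^ 2 * g := by
      rw [hκ]
      ring
    rw [h4]
    linarith

/-! ### Folding the error -/

section Folded

variable (a lam β : ℝ) (p01 p11 : I) {w : ℝ≥0 × I → ℝ≥0∞}

lemma foldedPOMDP_bellmanQ_false (hw : Measurable w) (e : ℝ≥0) (b : I) :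
    (foldedPOMDP a lam p01 p11).bellmanQ β w (e, b) false =
      ENNReal.ofReal ((e : ℝ) ^ 2) +
        ENNReal.ofReal β * ∫⁻ x, w (x, beliefUpdate p01 p11 b) ∂(foldedErr (a * e)) :=
  scheduleMDP_bellmanQ_false foldedErr (fun e => (e : ℝ)) measurable_subtype_coe a lam p01 p11 β
    hw e b

lemma foldedPOMDP_bellmanQ_true (hw : Measurable w) (e : ℝ≥0) (b : I) :
    (foldedPOMDP a lam p01 p11).bellmanQ β w (e, b) true =
      ENNReal.ofReal ((e : ℝ) ^ 2 + lam) +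
        ENNReal.ofReal β * (ENNReal.ofReal b * ∫⁻ x, w (x, p11) ∂(foldedErr 0) +
          ENNReal.ofReal (1 - b) * ∫⁻ x, w (x, p01) ∂(foldedErr (a * e))) :=
  scheduleMDP_bellmanQ_true foldedErr (fun e => (e : ℝ)) measurable_subtype_coe a lam p01 p11 β
    hw e b

end Folded

/-- Folding the error does not change the Bellman operator on even functions. -/
lemma foldedPOMDP_bellmanQ (a lam β : ℝ) (p01 p11 : I) {v : ℝ × I → ℝ≥0∞} {w : ℝ≥0 × I → ℝ≥0∞}
    (hv : Measurable v) (hw : Measurable w) (h : ∀ e b, v (e, b) = w (Real.nnabs e, b)) (e : ℝ)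
    (b : I) (u : Bool) :
    (originalPOMDP a lam p01 p11).bellmanQ β v (e, b) u =
      (foldedPOMDP a lam p01 p11).bellmanQ β w (Real.nnabs e, b) u := by
  have hwb (b : I) : Measurable fun x => w (x, b) := hw.comp (by fun_prop)
  have hfold (m : ℝ) (b : I) : ∫⁻ x, w (x, b) ∂(foldedErr m) = ∫⁻ x, v (x, b) ∂(gaussianReal m 1) := by
    change ∫⁻ x, w (x, b) ∂(foldedGaussian m) = _
    rw [foldedGaussian_eq_map, lintegral_map (hwb b) measurable_nnabs]
    simp_rw [h]
  -- The folded dynamics use the mean `a * |m|` instead of `a * m`; for an even integrand only the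
  -- modulus of the mean matters.
  have heven (m : ℝ) (b : I) :
      ∫⁻ x, w (x, b) ∂(foldedErr (a * |m|)) = ∫⁻ x, v (x, b) ∂(gaussianErr (a * m)) := by
    rw [hfold]
    have hvb : Measurable fun x => v (x, b) := hv.comp (by fun_prop)
    have hev (x : ℝ) : v (-x, b) = v (x, b) := by
      rw [h, h]
      congr 2
      ext
      simp
    change _ = ∫⁻ x, v (x, b) ∂(gaussianReal (a * m) 1)
    rw [← lintegral_gaussianReal_abs (a * |m|) hvb hev, ← lintegral_gaussianReal_abs (a * m) hvb hev,
      abs_mul, abs_abs, ← abs_mul]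
  cases u
  · rw [originalPOMDP, scheduleMDP_bellmanQ_false _ _ _ _ _ _ _ _ hv,
      foldedPOMDP_bellmanQ_false _ _ _ _ _ hw]
    simp only [Real.coe_nnabs, heven, sq_abs, id_eq]
  · rw [originalPOMDP, scheduleMDP_bellmanQ_true _ _ _ _ _ _ _ _ hv,
      foldedPOMDP_bellmanQ_true _ _ _ _ _ hw]
    simp only [Real.coe_nnabs, heven, sq_abs, id_eq, hfold]
    rfl

/-! ### Finiteness, structure and threshold of the value function -/

section Value

variable (a lam β : ℝ) (p01 p11 : I)

lemma measurable_originalPOMDP_cost (u : Bool) :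
    Measurable fun s => (originalPOMDP a lam p01 p11).cost s u :=
  measurable_scheduleMDP_cost _ _ _ _ _ _ _ u

lemma measurable_foldedPOMDP_cost (u : Bool) :
    Measurable fun s => (foldedPOMDP a lam p01 p11).cost s u :=
  measurable_scheduleMDP_cost _ _ _ _ _ _ _ u

lemma originalPOMDP_valueIter_eq (n : ℕ) (e : ℝ) (b : I) :
    (originalPOMDP a lam p01 p11).valueIter β n (e, b) =
      (foldedPOMDP a lam p01 p11).valueIter β n (Real.nnabs e, b) := by
  induction n generalizing e b with
  | zero => rfl
  | succ n ih =>
    have h := foldedPOMDP_bellmanQ a lam β p01 p11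
      (MDP.measurable_valueIter _ β (measurable_originalPOMDP_cost a lam p01 p11) n)
      (MDP.measurable_valueIter _ β (measurable_foldedPOMDP_cost a lam p01 p11) n) ih e b
    simp only [MDP.valueIter, MDP.bellman, h]

lemma originalPOMDP_value_eq (e : ℝ) (b : I) :
    (originalPOMDP a lam p01 p11).value β (e, b) =
      (foldedPOMDP a lam p01 p11).value β (Real.nnabs e, b) := by
  rw [MDP.value_eq_iSup _ β (measurable_originalPOMDP_cost a lam p01 p11),
    MDP.value_eq_iSup _ β (measurable_foldedPOMDP_cost a lam p01 p11)]
  simp_rw [originalPOMDP_valueIter_eq]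

lemma originalPOMDP_qValue_eq (e : ℝ) (b : I) (u : Bool) :
    (originalPOMDP a lam p01 p11).qValue β (e, b) u =
      (foldedPOMDP a lam p01 p11).qValue β (Real.nnabs e, b) u :=
  foldedPOMDP_bellmanQ a lam β p01 p11
    (MDP.measurable_value _ β (measurable_originalPOMDP_cost a lam p01 p11))
    (MDP.measurable_value _ β (measurable_foldedPOMDP_cost a lam p01 p11))
    (originalPOMDP_value_eq a lam β p01 p11) e b u

variable {a lam β p01 p11}

lemma exists_value_bound (hlam : 0 ≤ lam) (hβ0 : 0 < β) (hβ1 : β < 1) (hp : p01 ≤ p11)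
    (hstab : a ^ 2 * (1 - (p01 : ℝ)) < 1) :
    ∃ κ C : ℝ, 0 ≤ κ ∧ 0 ≤ C ∧ ∀ (e : ℝ) (b : I),
      (originalPOMDP a lam p01 p11).value β (e, b) ≤
        ENNReal.ofReal (e ^ 2 * (1 + κ * (1 - b)) + C) := by
  obtain ⟨κ, C, hκ, hC, h⟩ := exists_valueIter_bound a lam β p01 p11 hlam hβ0 hβ1 hp hstab
  refine ⟨κ, C, hκ, hC, fun e b => ?_⟩
  rw [MDP.value_eq_iSup _ β (measurable_originalPOMDP_cost a lam p01 p11)]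
  exact iSup_le fun n => h n e b

lemma gaussianMean_value_ne_top (hlam : 0 ≤ lam) (hβ0 : 0 < β) (hβ1 : β < 1) (hp : p01 ≤ p11)
    (hstab : a ^ 2 * (1 - (p01 : ℝ)) < 1) (m : ℝ) (b : I) :
    gaussianMean ((originalPOMDP a lam p01 p11).value β) m b ≠ ∞ := by
  obtain ⟨κ, C, hκ, hC, h⟩ := exists_value_bound hlam hβ0 hβ1 hp hstab
  refine ne_top_of_le_ne_top ?_ (lintegral_mono fun e => h e b)
  rw [lintegral_gaussianReal_quadratic m
    (add_nonneg zero_le_one (mul_nonneg hκ (sub_nonneg.2 b.2.2))) hC]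
  exact ENNReal.ofReal_ne_top

lemma structuredValue_value (hlam : 0 ≤ lam) (hβ0 : 0 < β) (hβ1 : β < 1) (hp : p01 ≤ p11)
    (hstab : a ^ 2 * (1 - (p01 : ℝ)) < 1) :
    StructuredValue lam ((originalPOMDP a lam p01 p11).value β) := by
  have hc := measurable_originalPOMDP_cost a lam p01 p11
  have hle (n : ℕ) (s : ℝ × I) : (originalPOMDP a lam p01 p11).valueIter β n s ≤
      (originalPOMDP a lam p01 p11).value β s := by
    rw [MDP.value_eq_iSup _ β hc]
    exact le_iSup (fun n => (originalPOMDP a lam p01 p11).valueIter β n s) n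
  rw [MDP.value_eq_iSup_fun _ β hc]
  refine StructuredValue.iSup (fun n => ?_) (MDP.monotone_valueIter _ β)
  induction n with
  | zero => exact StructuredValue.zero lam
  | succ n ih =>
    -- The passage to real numbers needs finite Gaussian means; each iterate lies below the value,
    -- whose means are finite by the quadratic bound.
    exact ih.bellman a hlam hβ0.le hβ1.le hp fun m b =>
      ne_top_of_le_ne_top (gaussianMean_value_ne_top hlam hβ0 hβ1 hp hstab m b)
        (lintegral_mono fun e => hle n (e, b))

/-- Transmitting is optimal exactly above a threshold for the belief. -/
lemma exists_optimalAction_threshold (hlam : 0 ≤ lam) (hβ0 : 0 < β) (hβ1 : β < 1)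
    (hp : p01 ≤ p11) (hstab : a ^ 2 * (1 - (p01 : ℝ)) < 1) (e : ℝ) :
    ∃ θ : ℝ, ∀ b : I, (originalPOMDP a lam p01 p11).OptimalAction β (e, b) true ↔ θ ≤ b := by
  have hS := structuredValue_value hlam hβ0 hβ1 hp hstab
  have hfin := gaussianMean_value_ne_top hlam hβ0 hβ1 hp hstab
  obtain ⟨θ, hθ⟩ := (hS.beliefStage hlam hβ0.le hβ1.le hp hfin (a * e)).exists_threshold
  refine ⟨θ, fun b => ?_⟩
  rw [← hθ, MDP.optimalAction_true_iff]
  have h0 := hS.bellmanQ_false_eq (p01 := p01) (p11 := p11) a hβ0.le hfin e b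
  have h1 := hS.bellmanQ_true_eq (p01 := p01) (p11 := p11) a hlam hβ0.le hfin e b
  change (originalPOMDP a lam p01 p11).bellmanQ β _ (e, b) true ≤
    (originalPOMDP a lam p01 p11).bellmanQ β _ (e, b) false ↔ _
  rw [h0, h1, ENNReal.ofReal_le_ofReal_iff
    (add_nonneg (sq_nonneg e) (mul_nonneg hβ0.le ENNReal.toReal_nonneg)), add_le_add_iff_left]

end Value

end

theorem corollary1 (a lam β : ℝ) (p01 p11 : I)
    (hlam : 0 ≤ lam) (hβ0 : 0 < β) (hβ1 : β < 1)
    (hp01 : 0 < p01) (hp : p01 ≤ p11)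
    (hstab : a ^ 2 * (1 - (p01 : ℝ)) < 1) :
    -- the value function is finite and satisfies the optimality equation
    (∀ (e : ℝ) (b : I),
      (originalPOMDP a lam p01 p11).value β (e, b) < ∞ ∧
      (originalPOMDP a lam p01 p11).value β (e, b) =
        min ((originalPOMDP a lam p01 p11).qValue β (e, b) false)
          ((originalPOMDP a lam p01 p11).qValue β (e, b) true)) ∧
    -- relation to the folded problem
    (∀ (e : ℝ) (b : I),
      (originalPOMDP a lam p01 p11).value β (e, b) =
        (foldedPOMDP a lam p01 p11).value β (Real.nnabs e, b) ∧
      ∀ u : Bool, (originalPOMDP a lam p01 p11).qValue β (e, b) u =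
        (foldedPOMDP a lam p01 p11).qValue β (Real.nnabs e, b) u) ∧
    -- (A) the value function is non-decreasing in the absolute value of the error
    (∀ (b : I) (e e' : ℝ), |e| ≤ |e'| →
      (originalPOMDP a lam p01 p11).value β (e, b) ≤
        (originalPOMDP a lam p01 p11).value β (e', b)) ∧
    -- (B) the value function is non-increasing in the belief
    (∀ (e : ℝ) (b b' : I), b ≤ b' →
      (originalPOMDP a lam p01 p11).value β (e, b') ≤
        (originalPOMDP a lam p01 p11).value β (e, b)) ∧
    -- (C) the inequality for mixtures of beliefs
    (∀ (e : ℝ) (x y z b : I), y ≤ x → (z : ℝ) = b * x + (1 - b) * y →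
      (originalPOMDP a lam p01 p11).value β (e, z) ≤
        ENNReal.ofReal ((1 - b) * lam)
          + ENNReal.ofReal b * (originalPOMDP a lam p01 p11).value β (e, x)
          + ENNReal.ofReal (1 - b) * (originalPOMDP a lam p01 p11).value β (e, y)) ∧
    -- (D) and the threshold structure of the optimal strategy
    (∃ thr : ℝ≥0 → ℝ,
      (foldedPOMDP a lam p01 p11).HasOptimalThreshold β thr ∧
      (originalPOMDP a lam p01 p11).HasOptimalThreshold β (fun e => thr (Real.nnabs e))) := by
  have hc := measurable_originalPOMDP_cost a lam p01 p11
  have hc' := measurable_foldedPOMDP_cost a lam p01 p11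
  have hS := structuredValue_value hlam hβ0 hβ1 hp hstab
  refine ⟨fun e b => ⟨?_, MDP.value_eq_min _ β hc _⟩, fun e b =>
    ⟨originalPOMDP_value_eq a lam β p01 p11 e b, originalPOMDP_qValue_eq a lam β p01 p11 e b⟩,
    hS.abs_mono, hS.belief_anti, hS.mix, ?_⟩
  · obtain ⟨κ, C, -, -, h⟩ := exists_value_bound hlam hβ0 hβ1 hp hstab
    exact (h e b).trans_lt ENNReal.ofReal_lt_top
  · choose θ hθ using exists_optimalAction_threshold hlam hβ0 hβ1 hp hstab
    have hiff (e : ℝ) (b : I) : (originalPOMDP a lam p01 p11).OptimalAction β (e, b) true ↔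
        (foldedPOMDP a lam p01 p11).OptimalAction β (Real.nnabs e, b) true := by
      simp only [MDP.OptimalAction, originalPOMDP_qValue_eq]
    -- The folded threshold is `θ` on nonnegative errors. The original problem takes `θ` at the
    -- modulus, so its threshold is even although the chosen `θ` need not be.
    have hfold (e : ℝ≥0) (b : I) :
        (foldedPOMDP a lam p01 p11).OptimalAction β (e, b) true ↔ θ (e : ℝ) ≤ b := by
      rw [← hθ, hiff, Real.nnabs_coe]
    refine ⟨fun e => θ e, MDP.hasOptimalThreshold_of_optimalAction_iff _ β hc' _ hfold,
      MDP.hasOptimalThreshold_of_optimalAction_iff _ β hc _ fun e b => ?_⟩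
    rw [hiff, hfold]
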